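/- Conventions. For $\xi\in\mathbb R^3\setminus\{0\}$ put $e_\xi=\xi/|\xi|$ and, for $a,b\in\mathbb C^3$, $a\odot_\xi b=-i\,(e_\xi\cdot b)\,\bigl(a-(e_\xi\cdot a)e_\xi\bigr)$ with the bilinear dot product. Let $\nu,T>0$ and let $\hat u_0:\mathbb R^3\to\mathbb C^3$ be measurable. A mild solution on $[0,T]$ with initial data $\hat u_0$ is a measurable $v:\mathbb R^3\times[0,T]\to\mathbb C^3$ such that for all $\xi\ne0$, $t\in[0,T]$, with absolutely convergent space-time integral, $$v(\xi,t)=e^{-\nu|\xi|^2t}\hat u_0(\xi)+\int_0^t e^{-\nu|\xi|^2s}\frac{|\xi|}{(2\pi)^{3/2}}\int_{\mathbb R^3}v(\eta,t-s)\odot_\xi v(\xi-\eta,t-s)\,d\eta\,ds .$$ A majorizing kernel is a measurable $h:\mathbb R^3\setminus\{0\}\to(0,\infty)$ with $h*h(\xi)<\infty$ for all $\xi\neq0$; put $m(\xi)=\dfrac{h*h(\xi)}{\nu(2\pi)^{3/2}|\xi|h(\xi)}$. Cascade (without thinning). A particle of frequency $\xi$ waits for an exponential time of intensity $\nu|\xi|^2$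 and then splits into two particles of frequencies $W_1,W_2=\xi-W_1$, where $W_1$ has density $\eta\mapsto h(\eta)h(\xi-\eta)/h*h(\xi)$; the offspring evolve in the same way, independently. Thus nodes $s$ of the binary tree carry frequencies $W_s$ ($W_\emptyset=\xi$), and holding times $T_s/(\nu|W_s|^2)$ with $T_s$ i.i.d. mean-one exponential and independent of the $W$'s. The explosion time is $\zeta_h(\xi)=\lim_n\min_{|s|=n}\sum_{j=1}^n|W_{s|j}|^{-2}T_{s|j}$; the cascade is non-explosive if $P(\zeta_h(\xi)<\infty)=0$ for all $\xi\ne0$. Let $\tau_t$ be the tree of the particles born by time $t$. When $\tau_t$ is finite, the cascade product $X(\tau_t)$ is defined recursively from the root: a particle of frequency $W$ alive at time $t$ contributes $\hat u_0(W)/h(W)$, a particle of frequency $W$ that branches contributes $m(W)$ times the $\odot_W$-product of the values of its two subtrees. If $E_\xi|X(\tau_t)|<\infty$ for all $\xi\neq0$, $t\in[0,T]$, we say that the cascade expectations of $\hat u_0$ exist, and the cascade solution is $\hat u(\xi,t)=h(\xi)E_\xi X(\tau_t)$. For a function $v$ on $\mathbb R^3\times[0,T]$ let $X_n^v(\xi,t)$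 be the same product, with initial data $v(\cdot,0)$, cut off at generation $n$: a particle of frequency $W$ born in generation $n$ at time $\sigma\le t$ contributes $v(W,t-\sigma)/h(W)$. We say that the cascade expectations of $v$ exist on $[0,T]$ if $(X_n^v(\xi,t))_{n\ge0}$ is uniformly integrable for all $\xi\ne0$, $t\in[0,T]$. Proposition. Let $h$ be a majorizing kernel whose cascade is non-explosive. Then: (a) For all $\xi\neq0$ and $t$, the tree $\tau_t$ is almost surely finite. (b) If the cascade expectations of $\hat u_0$ exist, then $\hat u$ is a mild solution on $[0,T]$ with initial data $\hat u_0$, and its cascade expectations exist on $[0,T]$. If moreover $\xi\cdot\hat u_0(\xi)=0$ for all $\xi$, then $\xi\cdot\hat u(\xi,t)=0$ for all $\xi\neq 0$, $t\in[0,T]$. (c) If $v$ is any mild solution on $[0,T]$ with initial data $\hat u_0$ whose cascade expectations exist on $[0,T]$, then the cascade expectations of $\hat u_0$ exist and $v(\xi,t)=\hat u(\xi,t)$ for all $\xi\ne0$, $t\in[0,T]$. (d) The conclusion of (c) also holds for every mild solution $v$ on $[0,T]$ with initial data $\hat u_0$ such that, for some $C$, $|v(\xi,t)|\le C\,h(\xi)$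 and $E_\xi\prod_{s}\max\{1,C\,m(W_s)\}<\infty$ for all $\xi\ne0$, $t\in[0,T]$, the product being over the particles $s$ that have branched by time $t$. (e) The condition of non-explosion is scaling-critical: for $r>0$, the rescaled kernel $h_r(\xi)=r^{-2}h(\xi/r)$ (corresponding to $u_r(x,t)=r\,u(rx,r^2t)$) satisfies, for every $\xi\ne0$, that $r^2\zeta_{h_r}(r\xi)$ and $\zeta_h(\xi)$ have the same distribution; in particular $h_r$ is non-explosive too. -/

import Mathlib

open MeasureTheory ProbabilityTheory Set

/-- Wave numbers (Fourier modes). -/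
abbrev Mode : Type := EuclideanSpace ℝ (Fin 3)

/-- Values of the Fourier transform of a velocity field. -/
abbrev CVec : Type := EuclideanSpace ℂ (Fin 3)

/-! ### The algebraic operation -/

/-- The bilinear product `x · w` of a real vector with a complex vector. -/
noncomputable def realDot (x : Mode) (w : CVec) : ℂ := ∑ i, (x i : ℂ) * w i

/-- The unit vector `e_ξ = ξ / |ξ|`. -/
noncomputable def unitDir (ξ : Mode) : Mode := ‖ξ‖⁻¹ • ξ

/-- The projection `π_{ξ^⊥} w = w - (e_ξ · w) e_ξ`. -/
noncomputable def perpProj (ξ : Mode) (w : CVec) : CVec :=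
  WithLp.toLp 2 (fun i => w i - realDot (unitDir ξ) w * (unitDir ξ i : ℂ))

/-- `a ⊙_ξ b = -i (e_ξ · b) π_{ξ^⊥} a`. -/
noncomputable def odot (ξ : Mode) (a b : CVec) : CVec :=
  (-Complex.I * realDot (unitDir ξ) b) • perpProj ξ a

/-! ### Mild solutions -/

/-- The integrand of the mild formulation, at lag `s` and frequency `η`. -/
noncomputable def mildIntegrand (ν : ℝ) (v : Mode → ℝ → CVec) (ξ : Mode) (t s : ℝ) (η : Mode) :
    CVec :=
  (Real.exp (-ν * ‖ξ‖ ^ 2 * s) * (‖ξ‖ / (2 * Real.pi) ^ (3 / 2 : ℝ))) •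
    odot ξ (v η (t - s)) (v (ξ - η) (t - s))

/-- `v` is a mild solution, on the time interval `[0, T]`, of the Fourier-transformed unforced
Navier-Stokes equations with viscosity `ν` and initial data `u₀`. The space-time integral is
required to converge absolutely. (At `t = 0` the equation says that `v` has initial data `u₀`.) -/
structure IsMildSolution (ν T : ℝ) (u₀ : Mode → CVec) (v : Mode → ℝ → CVec) : Prop where
  measurable : Measurable (fun p : Mode × Icc (0 : ℝ) T => v p.1 (p.2 : ℝ))
  integrable : ∀ ξ : Mode, ξ ≠ 0 → ∀ t ∈ Icc 0 T,
    Integrable (fun p : ℝ × Mode => mildIntegrand ν v ξ t p.1 p.2)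
      ((volume.restrict (Ioc 0 t)).prod volume)
  equation : ∀ ξ : Mode, ξ ≠ 0 → ∀ t ∈ Icc 0 T,
    v ξ t = Real.exp (-ν * ‖ξ‖ ^ 2 * t) • u₀ ξ +
      ∫ s in (0 : ℝ)..t, ∫ η : Mode, mildIntegrand ν v ξ t s η

/-! ### Majorizing kernels and the branching law -/

/-- The convolution `h * h (ξ)`, with values in `[0, ∞]`. -/
noncomputable def selfConv (h : Mode → ℝ) (ξ : Mode) : ENNReal :=
  ∫⁻ η : Mode, ENNReal.ofReal (h η) * ENNReal.ofReal (h (ξ - η))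

/-- A majorizing kernel: a measurable `h : ℝ³ ∖ {0} → (0, ∞)` with `h * h < ∞` off the origin.
(The value at the origin is irrelevant.) -/
structure MajorizingKernel where
  toFun : Mode → ℝ
  measurable : Measurable toFun
  pos : ∀ ξ, ξ ≠ 0 → 0 < toFun ξ
  conv_lt_top : ∀ ξ, ξ ≠ 0 → selfConv toFun ξ < ⊤

instance : CoeFun MajorizingKernel (fun _ => Mode → ℝ) := ⟨MajorizingKernel.toFun⟩

/-- The density `H(η | ξ) = h(η) h(ξ - η) / (h * h)(ξ)`. -/
noncomputable def branchDensity (h : MajorizingKernel) (ξ η : Mode) : ENNReal :=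
  ENNReal.ofReal (h η) * ENNReal.ofReal (h (ξ - η)) / selfConv h ξ

/-- The law of the first offspring frequency `W₁` of a particle of frequency `ξ ≠ 0`. -/
noncomputable def branchLaw (h : MajorizingKernel) (ξ : Mode) : Measure Mode :=
  volume.withDensity (branchDensity h ξ)

theorem measurable_selfConv {h : Mode → ℝ} (hm : Measurable h) : Measurable (selfConv h) := by
  unfold selfConv
  refine Measurable.lintegral_prod_right (f := fun ξ η : Mode =>
    ENNReal.ofReal (h η) * ENNReal.ofReal (h (ξ - η))) ?_
  fun_prop

theorem measurable_branchDensity (h : MajorizingKernel) :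
    Measurable (Function.uncurry (branchDensity h)) := by
  have h1 := h.measurable
  have h2 := measurable_selfConv h.measurable
  unfold branchDensity Function.uncurry
  fun_prop

theorem selfConv_pos (h : MajorizingKernel) (ξ : Mode) : selfConv h ξ ≠ 0 := by
  have h1 := h.measurable
  intro h0
  unfold selfConv at h0
  rw [lintegral_eq_zero_iff (by fun_prop)] at h0
  have hA : ∀ᵐ η : Mode ∂volume, η ≠ 0 := by
    simpa using (measure_eq_zero_iff_ae_notMem (μ := (volume : Measure Mode))).1
      (measure_singleton (0 : Mode))
  have hB : ∀ᵐ η : Mode ∂volume, η ≠ ξ := by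
    simpa using (measure_eq_zero_iff_ae_notMem (μ := (volume : Measure Mode))).1
      (measure_singleton ξ)
  have hF : ∀ᵐ η : Mode ∂volume, False := by
    filter_upwards [h0, hA, hB] with η e a b
    have p1 := h.pos η a
    have p2 := h.pos (ξ - η) (sub_ne_zero.2 (Ne.symm b))
    simp only [Pi.zero_apply, mul_eq_zero, ENNReal.ofReal_eq_zero] at e
    rcases e with e | e <;> linarith
  exact hF.exists.elim fun _ hx => hx

theorem branchLaw_univ (h : MajorizingKernel) {ξ : Mode} (hξ : ξ ≠ 0) :
    branchLaw h ξ univ = 1 := by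
  have h1 := h.measurable
  have e : ∀ η, branchDensity h ξ η =
      (ENNReal.ofReal (h η) * ENNReal.ofReal (h (ξ - η))) * (selfConv h ξ)⁻¹ := fun η => by
    rw [branchDensity, div_eq_mul_inv]
  rw [branchLaw, withDensity_apply _ MeasurableSet.univ, Measure.restrict_univ]
  simp_rw [e]
  rw [lintegral_mul_const _ (by fun_prop)]
  exact ENNReal.mul_inv_cancel (selfConv_pos h ξ) (h.conv_lt_top ξ hξ).ne

/-- The branching law can be sampled, jointly measurably in the parent frequency, by a function of
a uniform variable. -/
theorem exists_sampler (h : MajorizingKernel) :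
    ∃ G : Mode → unitInterval → Mode, Measurable (Function.uncurry G) ∧
      ∀ ξ, ξ ≠ 0 → (volume : Measure unitInterval).map (G ξ) = branchLaw h ξ := by
  classical
  let κ₀ : Kernel Mode Mode := Kernel.withDensity (Kernel.const Mode volume) (branchDensity h)
  have hκ₀ : ∀ ξ, κ₀ ξ = branchLaw h ξ := fun ξ => by
    rw [Kernel.withDensity_apply _ (measurable_branchDensity h), Kernel.const_apply, branchLaw]
  let κ : Kernel Mode Mode :=
    Kernel.piecewise (measurableSet_singleton (0 : Mode)).compl κ₀ (Kernel.const Mode (.dirac 0))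
  have hκ : ∀ ξ, ξ ≠ 0 → κ ξ = branchLaw h ξ := fun ξ hξ => by
    rw [Kernel.piecewise_apply, if_pos (by simpa using hξ), hκ₀]
  have : IsMarkovKernel κ := ⟨fun ξ => by
    by_cases hξ : ξ = 0
    · rw [Kernel.piecewise_apply, if_neg (by simpa using hξ), Kernel.const_apply]
      infer_instance
    · exact ⟨by rw [hκ ξ hξ, branchLaw_univ h hξ]⟩⟩
  obtain ⟨G, hG, hGκ⟩ := Kernel.exists_measurable_map_eq_unitInterval κ
  exact ⟨G, hG, fun ξ hξ => by rw [hGκ, hκ ξ hξ]⟩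

/-- A jointly measurable sampler of the branching law: for `U` uniform on `[0, 1]` and `ξ ≠ 0`,
`sampler h ξ U` has density `H(· | ξ)`. -/
noncomputable def sampler (h : MajorizingKernel) : Mode → unitInterval → Mode :=
  (exists_sampler h).choose

theorem measurable_sampler (h : MajorizingKernel) : Measurable (Function.uncurry (sampler h)) :=
  (exists_sampler h).choose_spec.1

theorem map_sampler (h : MajorizingKernel) {ξ : Mode} (hξ : ξ ≠ 0) :
    (volume : Measure unitInterval).map (sampler h ξ) = branchLaw h ξ :=
  (exists_sampler h).choose_spec.2 ξ hξ

/-! ### The cascade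

The nodes of the full binary tree are the finite words `s : List Bool`, read from the root; `false`
is the first child (of frequency `W₁`), `true` the second (of frequency `W₂`). -/

instance : IsProbabilityMeasure (expMeasure 1) := isProbabilityMeasure_expMeasure one_pos

/-- A point of the sample space carries at every node `s` a mean one exponential variable `T_s` and
a uniform variable, used to sample the offspring frequencies. -/
abbrev CascadeSpace : Type := List Bool → ℝ × unitInterval

/-- All variables at all nodes are independent. -/
noncomputable def cascadeMeasure : Measure CascadeSpace :=
  Measure.infinitePi (fun _ : List Bool => (expMeasure 1).prod (volume : Measure unitInterval))

/-- The variables in the subtree above child `b` of the root. -/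
def subtree (ω : CascadeSpace) (b : Bool) : CascadeSpace := fun s => ω (b :: s)

/-- Frequency of child `b` of a root of frequency `ξ`: `W₁` has law `branchLaw h ξ`, and
`W₂ = ξ - W₁`. -/
noncomputable def childMode (h : MajorizingKernel) (ξ : Mode) (ω : CascadeSpace) (b : Bool) :
    Mode :=
  if b then ξ - sampler h ξ (ω []).2 else sampler h ξ (ω []).2

/-- The frequency `W_s` at node `s` of the cascade started at `W_∅ = ξ`. -/
noncomputable def nodeMode (h : MajorizingKernel) : Mode → CascadeSpace → List Bool → Mode
  | ξ, _, [] => ξ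
  | ξ, ω, b :: s => nodeMode h (childMode h ξ ω b) (subtree ω b) s

/-- `ζ_n = min_{|s| = n} ∑_{j = 1}^n |W_{s|j}|⁻² T_{s|j}`. -/
noncomputable def explosionTimeAt (h : MajorizingKernel) (n : ℕ) (ξ : Mode) (ω : CascadeSpace) :
    ENNReal :=
  ⨅ (s : List Bool) (_ : s.length = n), ∑ j ∈ Finset.Icc 1 n,
    ENNReal.ofReal ((‖nodeMode h ξ ω (s.take j)‖ ^ 2)⁻¹ * (ω (s.take j)).1)

/-- The explosion time `ζ(ξ) = lim_n ζ_n`, the limit of a nondecreasing sequence. -/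
noncomputable def explosionTime (h : MajorizingKernel) (ξ : Mode) (ω : CascadeSpace) : ENNReal :=
  ⨆ n, explosionTimeAt h n ξ ω

/-- The explosion event `[ζ(ξ) < ∞]` has probability zero for every initial mode `ξ ≠ 0`. -/
def NonExplosive (h : MajorizingKernel) : Prop :=
  ∀ ξ : Mode, ξ ≠ 0 → cascadeMeasure {ω | explosionTime h ξ ω < ⊤} = 0

/-- Holding time of the root: exponential with intensity `ν |ξ|²`. -/
noncomputable def holdTime (ν : ℝ) (ξ : Mode) (ω : CascadeSpace) : ℝ :=
  (ω []).1 / (ν * ‖ξ‖ ^ 2)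

/-- The time at which the particle at node `s` is born. -/
noncomputable def birthTime (h : MajorizingKernel) (ν : ℝ) : Mode → CascadeSpace → List Bool → ℝ
  | _, _, [] => 0
  | ξ, ω, b :: s =>
      holdTime ν ξ ω + birthTime h ν (childMode h ξ ω b) (subtree ω b) s

/-- The genealogical tree `τ_t`: the particles born by time `t`. -/
def genealogy (h : MajorizingKernel) (ν : ℝ) (ξ : Mode) (t : ℝ) (ω : CascadeSpace) :
    Set (List Bool) :=
  {s | birthTime h ν ξ ω s ≤ t}

/-- The particles that have branched by time `t`, i.e. those with a child born by time `t`. -/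
def branchPoints (h : MajorizingKernel) (ν : ℝ) (ξ : Mode) (t : ℝ) (ω : CascadeSpace) :
    Set (List Bool) :=
  {s | s ++ [false] ∈ genealogy h ν ξ t ω}

/-- The factor `(h * h)(ξ) / (ν (2π)^{3/2} |ξ| h(ξ))` carried by a branching at frequency `ξ`. -/
noncomputable def branchFactor (h : MajorizingKernel) (ν : ℝ) (ξ : Mode) : ℝ :=
  (selfConv h ξ).toReal / (ν * (2 * Real.pi) ^ (3 / 2 : ℝ) * ‖ξ‖ * h ξ)

/-- For solutions bounded by `C h`: the product, over the branch points `s` of the (finite) tree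
`τ_t`, of `max (1, C * branchFactor h ν W_s)`. -/
noncomputable def majorantProduct (h : MajorizingKernel) (ν C : ℝ) (ξ : Mode) (t : ℝ)
    (ω : CascadeSpace) : ℝ :=
  ∏ᶠ s ∈ branchPoints h ν ξ t ω, max 1 (C * branchFactor h ν (nodeMode h ξ ω s))

/-- The cascade product cut off at generation `n`. A particle of generation `< n` and frequency `W`
that lives at the final time contributes `u₀(W) / h(W)`; one that branches contributes
`branchFactor h ν W` times the `⊙_W`-product of its two subtrees; a particle born in generation `n`,
with time `r` still to go, contributes `v(W, r) / h(W)`. -/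
noncomputable def truncatedProduct (h : MajorizingKernel) (ν : ℝ) (u₀ : Mode → CVec)
    (v : Mode → ℝ → CVec) : ℕ → Mode → ℝ → CascadeSpace → CVec
  | 0, ξ, t, _ => (h ξ)⁻¹ • v ξ t
  | n + 1, ξ, t, ω =>
      if t < holdTime ν ξ ω then (h ξ)⁻¹ • u₀ ξ
      else branchFactor h ν ξ • odot ξ
        (truncatedProduct h ν u₀ v n (childMode h ξ ω false) (t - holdTime ν ξ ω)
          (subtree ω false))
        (truncatedProduct h ν u₀ v n (childMode h ξ ω true) (t - holdTime ν ξ ω)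
          (subtree ω true))

open Classical in
/-- The cascade product `X(τ_t)` over the whole genealogical tree, defined when `τ_t` is finite
(and set to `0` otherwise). All words in a finite `τ_t` are shorter than its number of elements,
so that the cut-off at that generation is not felt. -/
noncomputable def cascadeProduct (h : MajorizingKernel) (ν : ℝ) (u₀ : Mode → CVec)
    (ξ : Mode) (t : ℝ) (ω : CascadeSpace) : CVec :=
  if (genealogy h ν ξ t ω).Finite then
    truncatedProduct h ν u₀ (fun _ _ => 0) (genealogy h ν ξ t ω).ncard ξ t ω
  else 0

/-- The expectation `E_ξ X(τ_t)` exists for all `ξ ≠ 0` and `t ∈ [0, T]`. -/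
def CascadeExpectationExists (h : MajorizingKernel) (ν T : ℝ) (u₀ : Mode → CVec) : Prop :=
  ∀ ξ : Mode, ξ ≠ 0 → ∀ t ∈ Icc 0 T, Integrable (cascadeProduct h ν u₀ ξ t) cascadeMeasure

/-- The stochastic cascade solution `û(ξ, t) = h(ξ) E_ξ X(τ_t)`. -/
noncomputable def cascadeSolution (h : MajorizingKernel) (ν : ℝ) (u₀ : Mode → CVec)
    (ξ : Mode) (t : ℝ) : CVec :=
  h ξ • ∫ ω, cascadeProduct h ν u₀ ξ t ω ∂cascadeMeasure

/-- The class in which uniqueness is asked: the expectations of the cascade products of `v`, cut off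
at the generations `n = 0, 1, 2, …`, exist uniformly in `n`. -/
def HasCascadeExpectations (h : MajorizingKernel) (ν T : ℝ) (v : Mode → ℝ → CVec) : Prop :=
  ∀ ξ : Mode, ξ ≠ 0 → ∀ t ∈ Icc 0 T,
    UniformIntegrable (fun n => truncatedProduct h ν (fun η => v η 0) v n ξ t) 1 cascadeMeasure

/-! ### Scaling -/

theorem selfConv_rescale (h : Mode → ℝ) (hm : Measurable h) {r : ℝ} (hr : 0 < r) (ξ : Mode) :
    selfConv (fun η => (r ^ 2)⁻¹ * h (r⁻¹ • η)) ξ = ENNReal.ofReal r⁻¹ * selfConv h (r⁻¹ • ξ) := by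
  have hF : Measurable (fun η : Mode => ENNReal.ofReal ((r ^ 2)⁻¹ * h η) *
      ENNReal.ofReal ((r ^ 2)⁻¹ * h (r⁻¹ • ξ - η))) := by fun_prop
  have key : ∀ F : Mode → ENNReal, Measurable F →
      ∫⁻ η, F (r⁻¹ • η) = ENNReal.ofReal (r ^ 3) * ∫⁻ η, F η := by
    intro F hF
    rw [← lintegral_map (μ := volume) (g := fun η : Mode => r⁻¹ • η) hF (by fun_prop),
      Measure.map_addHaar_smul volume (inv_ne_zero hr.ne'), lintegral_smul_measure, smul_eq_mul]
    congr 2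
    simp [abs_of_pos hr]
  have h2 : 0 ≤ (r ^ 2)⁻¹ := by positivity
  unfold selfConv
  calc _ = ∫⁻ η, (fun η : Mode => ENNReal.ofReal ((r ^ 2)⁻¹ * h η) *
      ENNReal.ofReal ((r ^ 2)⁻¹ * h (r⁻¹ • ξ - η))) (r⁻¹ • η) := by
        simp only [smul_sub]
    _ = ENNReal.ofReal (r ^ 3) * ∫⁻ η, (ENNReal.ofReal ((r ^ 2)⁻¹) * ENNReal.ofReal ((r ^ 2)⁻¹)) *
        (ENNReal.ofReal (h η) * ENNReal.ofReal (h (r⁻¹ • ξ - η))) := by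
        rw [key _ hF]
        congr 1
        refine lintegral_congr fun η => ?_
        rw [ENNReal.ofReal_mul h2, ENNReal.ofReal_mul h2]
        ring
    _ = _ := by
        rw [lintegral_const_mul _ (by fun_prop), ← mul_assoc, ← ENNReal.ofReal_mul h2,
          ← ENNReal.ofReal_mul (by positivity)]
        congr 2
        field_simp

/-- The kernel `h_r(ξ) = r⁻² h(ξ / r)`. This is how Fourier transforms of velocity fields change
under the Navier-Stokes scaling `u_r(x, t) = r u(r x, r² t)`: `û_r(ξ, t) = r⁻² û(ξ / r, r² t)`. -/
noncomputable def MajorizingKernel.rescale (h : MajorizingKernel) (r : ℝ) (hr : 0 < r) :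
    MajorizingKernel where
  toFun ξ := (r ^ 2)⁻¹ * h (r⁻¹ • ξ)
  measurable := by
    have := h.measurable
    fun_prop
  pos ξ hξ := mul_pos (by positivity) (h.pos _ (smul_ne_zero (inv_ne_zero hr.ne') hξ))
  conv_lt_top ξ hξ := by
    rw [selfConv_rescale h h.measurable hr]
    exact ENNReal.mul_lt_top ENNReal.ofReal_lt_top
      (h.conv_lt_top _ (smul_ne_zero (inv_ne_zero hr.ne') hξ))

/-!
# The stochastic cascade of the Fourier-transformed Navier-Stokes equations

The proof rests on the branching property `map_split`: the variables at the root of the cascade and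
those in the two subtrees above it are independent, and each subtree is distributed like the whole
tree. Together with the law of the root it gives the law of the first step, `map_firstStep`, in
which the holding time and the first offspring frequency have the density `stepDensity`. The
branching factor is chosen so that `stepDensity` times the factors of a branching reproduces the
integrand of the mild formulation (`stepDensity_smul_odot`). Hence, if a functional `Z` of the
cascade is obtained from a family `F` by one step of the recursion that defines cascade products,
`h E Z` is the right-hand side of the mild equation at `h E F` (`mild_of_step`), the expectation
of the product over two independent subtrees being the product of the expectations.

* *Finiteness.* A particle of generation `> n` is born after time `ζ_n / ν`, so that `ζ = ∞` leaves
  finitely many particles by any given time (`finite_genealogy`).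
* *Existence.* The cascade product satisfies its own recursion almost surely, so `mild_of_step` with
  `Z = F = X` says that `h E X` is a mild solution. Averaging `X` over the variables in the
  generations `≥ n` gives the product of this solution cut off at generation `n`
  (`ae_integral_cascadeProduct_resample`). Thus the cut-off products are conditional expectations of
  the integrable variable `X`, hence uniformly integrable.
* *Uniqueness.* For a mild solution `v`, `mild_of_step` with `F = X_n^v` and `Z = X_{n+1}^v` shows
  by induction that `h E X_n^v = v` for every `n` (`integral_truncatedProduct`). Since the tree is
  finite, `X_n^v` is eventually equal to `X`, and uniform integrability allows the limit to be taken
  under the expectation. If `|v| ≤ C h`, the majorant product dominates all the `X_n^v`, because a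
  binary tree has one more leaf than branch points (`norm_truncatedProduct_le`), and dominated
  convergence applies instead.
* *Scaling.* The branching law of the rescaled kernel is the image of the original one under
  multiplication by `r` (`branchLaw_rescale`). The samplers being arbitrary, the two cascades are only
  equal in law, and the laws of the `ζ_n` are compared by induction on the generation. The `ζ_n`
  increase to `ζ`, whose law is therefore determined by theirs (`map_iSup_apply_Iic`).

Identities between cascade functionals are proved for realizations with positive exponential
variables and no vanishing frequency (`IsNondegenerate`), which is an almost sure event.
-/


/-! ### Independence structure of the sample space -/

instance : IsProbabilityMeasure cascadeMeasure := by
  unfold cascadeMeasure; infer_instance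

/-- The law of the pair of variables carried by one node. -/
noncomputable abbrev nodeLaw : Measure (ℝ × unitInterval) :=
  (expMeasure 1).prod (volume : Measure unitInterval)

/-- Assembles a point of the sample space from the variables at the root and those in the two
subtrees above it. -/
def graft (p : (ℝ × unitInterval) × (CascadeSpace × CascadeSpace)) : CascadeSpace
  | [] => p.1
  | false :: s => p.2.1 s
  | true :: s => p.2.2 s

theorem measurable_graft : Measurable graft := by
  refine measurable_pi_iff.2 fun s => ?_
  rcases s with _ | ⟨_ | _, s⟩ <;> simp only [graft] <;> fun_prop

theorem measurable_subtree (b : Bool) : Measurable (fun ω => subtree ω b) :=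
  measurable_pi_iff.2 fun s => measurable_pi_apply (b :: s)

theorem map_graft :
    (nodeLaw.prod (cascadeMeasure.prod cascadeMeasure)).map graft = cascadeMeasure := by
  classical
  refine Measure.eq_infinitePi _ fun s t ht => ?_
  have hinj : ∀ b : Bool, Set.InjOn (fun u : List Bool => b :: u) ((b :: ·) ⁻¹' (s : Set (List Bool))) :=
    fun b x _ y _ h => by simpa using h
  set S : Bool → Finset (List Bool) := fun b => s.preimage (b :: ·) (hinj b) with hS
  have hpre : graft ⁻¹' (Set.pi s t) =
      (if [] ∈ s then t [] else univ) ×ˢ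
        ((Set.pi (S false) fun u => t (false :: u)) ×ˢ (Set.pi (S true) fun u => t (true :: u))) := by
    ext p
    simp only [mem_preimage, Set.mem_pi, mem_prod, hS, Finset.mem_coe, Finset.mem_preimage]
    constructor
    · intro H
      refine ⟨?_, fun u hu => H _ hu, fun u hu => H _ hu⟩
      split_ifs with h0
      · exact H [] h0
      · trivial
    · rintro ⟨h0, h1, h2⟩ (_ | ⟨_ | _, u⟩) hu
      · rw [if_pos hu] at h0
        exact h0
      · exact h1 u hu
      · exact h2 u hu
  have hmeas : ∀ b : Bool, ∀ i ∈ S b, MeasurableSet (t (b :: i)) := fun b i _ => ht _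
  rw [Measure.map_apply measurable_graft (.pi s.countable_toSet fun i _ => ht i), hpre,
    Measure.prod_prod, Measure.prod_prod, cascadeMeasure, Measure.infinitePi_pi _ (hmeas false),
    Measure.infinitePi_pi _ (hmeas true)]
  set f : List Bool → ENNReal := fun i => nodeLaw (t i)
  let g : Bool → List Bool → ENNReal := fun b i => if i.head? = some b then f i else 1
  have hf : ∀ i, f i = (if i = [] then f [] else 1) * (g false i * g true i) := by
    rintro (_ | ⟨_ | _, u⟩) <;> simp [g]
  have hg : ∀ b, ∏ i ∈ S b, f (b :: i) = ∏ i ∈ s, g b i := by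
    intro b
    rw [← Finset.prod_preimage (b :: ·) s (hinj b) (g b)]
    · simp [g, hS]
    · rintro (_ | ⟨c, u⟩) _ hu
      · simp [g]
      · simp only [g, List.head?_cons, Option.some.injEq, ite_eq_right_iff]
        rintro rfl
        exact absurd ⟨u, rfl⟩ hu
  calc _ = (if [] ∈ s then f [] else 1) *
        ((∏ i ∈ S false, f (false :: i)) * ∏ i ∈ S true, f (true :: i)) := by
        congr 1
        split_ifs with h0
        · rfl
        · exact measure_univ
    _ = ∏ i ∈ s, f i := by
        rw [hg, hg, Finset.prod_congr rfl fun i _ => hf i, Finset.prod_mul_distrib,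
          Finset.prod_mul_distrib, Finset.prod_ite_eq' s [] fun _ => f []]

/-- The variables at the root and in the two subtrees above it. -/
def split (ω : CascadeSpace) : (ℝ × unitInterval) × (CascadeSpace × CascadeSpace) :=
  (ω [], subtree ω false, subtree ω true)

theorem measurable_split : Measurable split :=
  (measurable_pi_apply []).prodMk ((measurable_subtree false).prodMk (measurable_subtree true))

/-- The branching property: the variables at the root and in the two subtrees above it are
independent, and each subtree is distributed like the whole tree. -/
theorem map_split :
    cascadeMeasure.map split = nodeLaw.prod (cascadeMeasure.prod cascadeMeasure) := by
  conv_lhs => rw [← map_graft]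
  rw [Measure.map_map measurable_split measurable_graft]
  exact Measure.map_id

theorem map_subtrees :
    cascadeMeasure.map (fun ω => (subtree ω false, subtree ω true)) =
      cascadeMeasure.prod cascadeMeasure := by
  have : (fun ω => (subtree ω false, subtree ω true)) = Prod.snd ∘ split := rfl
  rw [this, ← Measure.map_map measurable_snd measurable_split, map_split, Measure.map_snd_prod,
    measure_univ, one_smul]

/-- The point of the sample space with the variables of `p.1` in the generations `< n` and those of
`p.2` in the generations `≥ n`. -/
def resample (n : ℕ) (p : CascadeSpace × CascadeSpace) : CascadeSpace :=
  fun s => if s.length < n then p.1 s else p.2 s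

theorem measurable_resample (n : ℕ) : Measurable (resample n) := by
  refine measurable_pi_iff.2 fun s => ?_
  unfold resample
  split_ifs <;> fun_prop

theorem map_resample (n : ℕ) :
    (cascadeMeasure.prod cascadeMeasure).map (resample n) = cascadeMeasure := by
  classical
  refine Measure.eq_infinitePi _ fun s t ht => ?_
  have hpre : resample n ⁻¹' (Set.pi s t) =
      (Set.pi (s.filter fun u => u.length < n : Finset _) t) ×ˢ
        (Set.pi (s.filter fun u => ¬ u.length < n : Finset _) t) := by
    ext p
    simp only [mem_preimage, Set.mem_pi, mem_prod, Finset.mem_coe, Finset.mem_filter, resample]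
    constructor
    · intro H
      refine ⟨fun u hu => ?_, fun u hu => ?_⟩
      · simpa [hu.2] using H u hu.1
      · simpa [hu.2] using H u hu.1
    · rintro ⟨h1, h2⟩ u hu
      split_ifs with h
      · exact h1 u ⟨hu, h⟩
      · exact h2 u ⟨hu, h⟩
  rw [Measure.map_apply (measurable_resample n) (.pi s.countable_toSet fun i _ => ht i), hpre,
    Measure.prod_prod, cascadeMeasure, Measure.infinitePi_pi _ fun i _ => ht i,
    Measure.infinitePi_pi _ fun i _ => ht i, Finset.prod_filter_mul_prod_filter_not]

theorem subtree_resample (n : ℕ) (p : CascadeSpace × CascadeSpace) (b : Bool) :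
    subtree (resample (n + 1) p) b = resample n (subtree p.1 b, subtree p.2 b) := by
  funext s
  simp [subtree, resample]

theorem resample_zero (p : CascadeSpace × CascadeSpace) : resample 0 p = p.2 := by
  funext s
  simp [resample]

theorem resample_succ_nil (n : ℕ) (p : CascadeSpace × CascadeSpace) :
    resample (n + 1) p [] = p.1 [] := by
  simp [resample]

/-! ### The first branching -/

theorem map_div_expMeasure {c : ℝ} (hc : 0 < c) :
    (expMeasure 1).map (fun x => x / c) = expMeasure c := by
  have := isProbabilityMeasure_expMeasure hc
  have hm : Measurable fun x : ℝ => x / c := by fun_prop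
  have := Measure.isProbabilityMeasure_map (μ := expMeasure 1) hm.aemeasurable
  refine Measure.eq_of_cdf _ _ ?_
  ext x
  have hpre : (fun x : ℝ => x / c) ⁻¹' Iic x = Iic (c * x) := by
    ext y
    simp [div_le_iff₀ hc, mul_comm]
  have e : cdf ((expMeasure 1).map fun x => x / c) x = cdf (expMeasure 1) (c * x) := by
    rw [cdf_eq_real, cdf_eq_real, map_measureReal_apply hm measurableSet_Iic, hpre]
  rw [e, cdf_expMeasure_eq one_pos, cdf_expMeasure_eq hc]
  simp [mul_nonneg_iff_of_pos_left hc]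

theorem isProbabilityMeasure_branchLaw (h : MajorizingKernel) {ξ : Mode} (hξ : ξ ≠ 0) :
    IsProbabilityMeasure (branchLaw h ξ) := ⟨branchLaw_univ h hξ⟩

instance (h : MajorizingKernel) (ξ : Mode) : SFinite (branchLaw h ξ) := by
  unfold branchLaw; infer_instance

/-- The law of the first step of the cascade: the exponential variable at the root, the first
offspring frequency, and the two subtrees. -/
theorem map_firstStep (h : MajorizingKernel) {ξ : Mode} (hξ : ξ ≠ 0) :
    cascadeMeasure.map (fun ω => (((ω []).1, sampler h ξ (ω []).2),
        (subtree ω false, subtree ω true))) =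
      ((expMeasure 1).prod (branchLaw h ξ)).prod (cascadeMeasure.prod cascadeMeasure) := by
  have hG : Measurable (sampler h ξ) := (measurable_sampler h).of_uncurry_left
  have e : (fun ω : CascadeSpace => (((ω []).1, sampler h ξ (ω []).2),
      (subtree ω false, subtree ω true))) =
      Prod.map (Prod.map id (sampler h ξ)) id ∘ split := rfl
  have := isProbabilityMeasure_branchLaw h hξ
  rw [e, ← Measure.map_map ((measurable_id.prodMap hG).prodMap measurable_id) measurable_split,
    map_split, ← Measure.map_prod_map _ _ (measurable_id.prodMap hG) measurable_id,
    ← Measure.map_prod_map _ _ measurable_id hG, Measure.map_id, Measure.map_id, map_sampler h hξ]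

/-- `map_firstStep` with the holding time of the root in place of its exponential variable. -/
theorem map_firstStep_holdTime (h : MajorizingKernel) {ν : ℝ} (hν : 0 < ν) {ξ : Mode}
    (hξ : ξ ≠ 0) :
    cascadeMeasure.map (fun ω => ((holdTime ν ξ ω, sampler h ξ (ω []).2),
        (subtree ω false, subtree ω true))) =
      ((expMeasure (ν * ‖ξ‖ ^ 2)).prod (branchLaw h ξ)).prod
        (cascadeMeasure.prod cascadeMeasure) := by
  have hc : 0 < ν * ‖ξ‖ ^ 2 := by positivity
  have hm : Measurable fun x : ℝ => x / (ν * ‖ξ‖ ^ 2) := by fun_prop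
  have hG : Measurable (sampler h ξ) := (measurable_sampler h).of_uncurry_left
  have e : (fun ω : CascadeSpace => ((holdTime ν ξ ω, sampler h ξ (ω []).2),
      (subtree ω false, subtree ω true))) =
      Prod.map (Prod.map (fun x => x / (ν * ‖ξ‖ ^ 2)) id) id ∘
      (fun ω : CascadeSpace => (((ω []).1, sampler h ξ (ω []).2),
        (subtree ω false, subtree ω true))) := rfl
  have hF : Measurable (fun ω : CascadeSpace => (((ω []).1, sampler h ξ (ω []).2),
      (subtree ω false, subtree ω true))) :=
    ((measurable_pi_apply []).fst.prodMk (hG.comp (measurable_pi_apply []).snd)).prodMk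
      ((measurable_subtree false).prodMk (measurable_subtree true))
  have := isProbabilityMeasure_branchLaw h hξ
  have := isProbabilityMeasure_expMeasure hc
  rw [e, ← Measure.map_map ((hm.prodMap measurable_id).prodMap measurable_id) hF,
    map_firstStep h hξ, ← Measure.map_prod_map _ _ (hm.prodMap measurable_id) measurable_id,
    ← Measure.map_prod_map _ _ hm measurable_id, Measure.map_id, Measure.map_id,
    map_div_expMeasure hc]

theorem measurable_childMode (h : MajorizingKernel) (b : Bool) :
    Measurable (fun p : Mode × CascadeSpace => childMode h p.1 p.2 b) := by
  have h1 : Measurable (fun p : Mode × CascadeSpace => sampler h p.1 (p.2 []).2) :=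
    (measurable_sampler h).comp
      (measurable_fst.prodMk ((measurable_pi_apply []).comp measurable_snd).snd)
  unfold childMode
  cases b
  · simpa using h1
  · exact measurable_fst.sub h1

theorem measurable_holdTime (ν : ℝ) :
    Measurable (fun p : Mode × CascadeSpace => holdTime ν p.1 p.2) := by
  unfold holdTime
  have : Measurable (fun p : Mode × CascadeSpace => p.2 []) :=
    (measurable_pi_apply []).comp measurable_snd
  fun_prop

theorem ae_ne_volume (a : Mode) : ∀ᵐ η : Mode ∂volume, η ≠ a := by
  simpa using (measure_eq_zero_iff_ae_notMem (μ := (volume : Measure Mode))).1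
    (measure_singleton a)

theorem ae_branchLaw_ne (h : MajorizingKernel) (ξ : Mode) :
    ∀ᵐ η ∂branchLaw h ξ, η ≠ 0 ∧ ξ - η ≠ 0 := by
  refine (withDensity_absolutelyContinuous _ _).ae_le ?_
  filter_upwards [ae_ne_volume 0, ae_ne_volume ξ] with η h0 h1
  exact ⟨h0, sub_ne_zero.2 h1.symm⟩

/-- A property that holds almost surely at every nonzero frequency holds almost surely for both
offspring of a particle. -/
theorem ae_child (h : MajorizingKernel) {ν : ℝ} (hν : 0 < ν)
    {p : Mode → ℝ → CascadeSpace → Prop}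
    (hp : MeasurableSet {q : Mode × ℝ × CascadeSpace | p q.1 q.2.1 q.2.2})
    (H : ∀ η, η ≠ 0 → ∀ r, ∀ᵐ ω ∂cascadeMeasure, p η r ω) {ξ : Mode} (hξ : ξ ≠ 0) (t : ℝ) :
    ∀ᵐ ω ∂cascadeMeasure, ∀ b, p (childMode h ξ ω b) (t - holdTime ν ξ ω) (subtree ω b) := by
  have hG : Measurable (sampler h ξ) := (measurable_sampler h).of_uncurry_left
  have hF : Measurable (fun ω : CascadeSpace => ((holdTime ν ξ ω, sampler h ξ (ω []).2),
      (subtree ω false, subtree ω true))) :=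
    (((measurable_holdTime ν).of_uncurry_left (x := ξ)).prodMk
      (hG.comp (measurable_pi_apply []).snd)).prodMk
      ((measurable_subtree false).prodMk (measurable_subtree true))
  let q : (ℝ × Mode) × CascadeSpace × CascadeSpace → Prop := fun z =>
    p z.1.2 (t - z.1.1) z.2.1 ∧ p (ξ - z.1.2) (t - z.1.1) z.2.2
  have hp1 : MeasurableSet {z : (ℝ × Mode) × CascadeSpace × CascadeSpace |
      p z.1.2 (t - z.1.1) z.2.1} := by
    have : Measurable fun z : (ℝ × Mode) × CascadeSpace × CascadeSpace =>
      (z.1.2, t - z.1.1, z.2.1) := by fun_prop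
    exact this hp
  have hp2 : MeasurableSet {z : (ℝ × Mode) × CascadeSpace × CascadeSpace |
      p (ξ - z.1.2) (t - z.1.1) z.2.2} := by
    have : Measurable fun z : (ℝ × Mode) × CascadeSpace × CascadeSpace =>
      (ξ - z.1.2, t - z.1.1, z.2.2) := by fun_prop
    exact this hp
  have hq : MeasurableSet {z | q z} := hp1.inter hp2
  have key : ∀ᵐ z ∂((expMeasure (ν * ‖ξ‖ ^ 2)).prod (branchLaw h ξ)).prod
      (cascadeMeasure.prod cascadeMeasure), q z := by
    rw [Measure.ae_prod_iff_ae_ae hq]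
    have h2 : ∀ᵐ y ∂(expMeasure (ν * ‖ξ‖ ^ 2)).prod (branchLaw h ξ),
        y.2 ≠ 0 ∧ ξ - y.2 ≠ 0 := Measure.quasiMeasurePreserving_snd.ae (ae_branchLaw_ne h ξ)
    filter_upwards [h2] with y hy
    exact (Measure.quasiMeasurePreserving_fst.ae (H _ hy.1 (t - y.1))).and
      (Measure.quasiMeasurePreserving_snd.ae (H _ hy.2 (t - y.1)))
  rw [← map_firstStep_holdTime h hν hξ] at key
  filter_upwards [ae_of_ae_map hF.aemeasurable key] with ω hω
  rintro (_ | _)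
  · simpa [childMode] using hω.1
  · simpa [childMode] using hω.2

/-! ### Measurability of the cascade -/

theorem measurable_child_subtree (h : MajorizingKernel) (b : Bool) :
    Measurable (fun p : Mode × CascadeSpace => (childMode h p.1 p.2 b, subtree p.2 b)) :=
  (measurable_childMode h b).prodMk ((measurable_subtree b).comp measurable_snd)

theorem measurable_nodeMode (h : MajorizingKernel) (s : List Bool) :
    Measurable (fun p : Mode × CascadeSpace => nodeMode h p.1 p.2 s) := by
  induction s with
  | nil => exact measurable_fst
  | cons b s ih => exact ih.comp (measurable_child_subtree h b)

theorem measurable_birthTime (h : MajorizingKernel) (ν : ℝ) (s : List Bool) :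
    Measurable (fun p : Mode × CascadeSpace => birthTime h ν p.1 p.2 s) := by
  induction s with
  | nil => exact measurable_const
  | cons b s ih => exact (measurable_holdTime ν).add (ih.comp (measurable_child_subtree h b))

theorem measurable_unitDir : Measurable unitDir := by
  unfold unitDir
  fun_prop

section

variable {α : Type*} [MeasurableSpace α]

theorem Measurable.realDot {x : α → Mode} {w : α → CVec} (hx : Measurable x)
    (hw : Measurable w) : Measurable fun a => realDot (x a) (w a) := by
  unfold _root_.realDot
  fun_prop

theorem Measurable.perpProj {x : α → Mode} {w : α → CVec} (hx : Measurable x)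
    (hw : Measurable w) : Measurable fun a => perpProj (x a) (w a) := by
  have h0 : Measurable fun a => unitDir (x a) := measurable_unitDir.comp hx
  have h1 := h0.realDot hw
  refine (WithLp.measurable_toLp 2 (Fin 3 → ℂ)).comp (measurable_pi_iff.2 fun i => ?_)
  have h5 : Measurable fun a => (unitDir (x a) i : ℂ) := by fun_prop
  have h6 : Measurable fun a => w a i := by fun_prop
  exact h6.sub (h1.mul h5)

theorem Measurable.odot {x : α → Mode} {w z : α → CVec} (hx : Measurable x)
    (hw : Measurable w) (hz : Measurable z) : Measurable fun a => odot (x a) (w a) (z a) :=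
  Measurable.smul (((measurable_unitDir.comp hx).realDot hz).const_mul _) (hx.perpProj hw)

end

theorem measurable_branchFactor (h : MajorizingKernel) (ν : ℝ) :
    Measurable (branchFactor h ν) := by
  have h1 := h.measurable
  have h2 := measurable_selfConv h.measurable
  unfold branchFactor
  fun_prop

theorem measurable_truncatedProduct (h : MajorizingKernel) (ν : ℝ) {u : Mode → CVec}
    (hu : Measurable u) {v : Mode → ℝ → CVec} (hv : Measurable fun p : Mode × ℝ => v p.1 p.2)
    (n : ℕ) :
    Measurable fun p : Mode × ℝ × CascadeSpace => truncatedProduct h ν u v n p.1 p.2.1 p.2.2 := by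
  have h1 := h.measurable
  induction n with
  | zero =>
    have : Measurable fun p : Mode × ℝ × CascadeSpace => v p.1 p.2.1 :=
      hv.comp (measurable_fst.prodMk measurable_snd.fst)
    simp only [truncatedProduct]
    fun_prop
  | succ n ih =>
    have hT : Measurable fun p : Mode × ℝ × CascadeSpace => holdTime ν p.1 p.2.2 :=
      (measurable_holdTime ν).comp (measurable_fst.prodMk measurable_snd.snd)
    have hb : ∀ b, Measurable fun p : Mode × ℝ × CascadeSpace =>
        truncatedProduct h ν u v n (childMode h p.1 p.2.2 b) (p.2.1 - holdTime ν p.1 p.2.2)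
          (subtree p.2.2 b) := fun b => by
      have hc : Measurable fun p : Mode × ℝ × CascadeSpace =>
          (childMode h p.1 p.2.2 b, subtree p.2.2 b) :=
        (measurable_child_subtree h b).comp (measurable_fst.prodMk measurable_snd.snd)
      exact ih.comp (hc.fst.prodMk ((measurable_snd.fst.sub hT).prodMk hc.snd))
    have hm := measurable_branchFactor h ν
    simp only [truncatedProduct]
    refine Measurable.ite (measurableSet_lt measurable_snd.fst hT) (by fun_prop) ?_
    have h3 : Measurable fun p : Mode × ℝ × CascadeSpace => branchFactor h ν p.1 :=
      hm.comp measurable_fst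
    exact Measurable.smul h3 (measurable_fst.odot (hb false) (hb true))

theorem measurableSet_genealogy_eq (h : MajorizingKernel) (ν : ℝ) (F : Finset (List Bool)) :
    MeasurableSet {p : Mode × ℝ × CascadeSpace | genealogy h ν p.1 p.2.1 p.2.2 = F} := by
  have hs : ∀ s, MeasurableSet {p : Mode × ℝ × CascadeSpace |
      birthTime h ν p.1 p.2.2 s ≤ p.2.1} := fun s =>
    measurableSet_le ((measurable_birthTime h ν s).comp (measurable_fst.prodMk measurable_snd.snd))
      measurable_snd.fst
  have : {p : Mode × ℝ × CascadeSpace | genealogy h ν p.1 p.2.1 p.2.2 = F} =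
      ⋂ s : List Bool, {p | birthTime h ν p.1 p.2.2 s ≤ p.2.1 ↔ s ∈ F} := by
    ext p
    simp only [genealogy, mem_ofPred_eq, mem_iInter, Set.ext_iff, Finset.mem_coe]
  rw [this]
  refine MeasurableSet.iInter fun s => ?_
  by_cases hF : s ∈ F
  · simpa only [hF, iff_true] using hs s
  · simpa only [hF, iff_false, compl_ofPred] using (hs s).compl

theorem measurable_cascadeProduct (h : MajorizingKernel) (ν : ℝ) {u : Mode → CVec}
    (hu : Measurable u) :
    Measurable fun p : Mode × ℝ × CascadeSpace => cascadeProduct h ν u p.1 p.2.1 p.2.2 := by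
  classical
  let A : Option (Finset (List Bool)) → Set (Mode × ℝ × CascadeSpace) := fun o =>
    o.elim {p | ¬ (genealogy h ν p.1 p.2.1 p.2.2).Finite}
      fun F => {p | genealogy h ν p.1 p.2.1 p.2.2 = F}
  let f : Option (Finset (List Bool)) → Mode × ℝ × CascadeSpace → CVec := fun o p =>
    o.elim 0 fun F => truncatedProduct h ν u (fun _ _ => 0) F.card p.1 p.2.1 p.2.2
  have hcover : {p : Mode × ℝ × CascadeSpace | ¬ (genealogy h ν p.1 p.2.1 p.2.2).Finite} =
      (⋃ F : Finset (List Bool), {p | genealogy h ν p.1 p.2.1 p.2.2 = F})ᶜ := by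
    ext p
    simp only [mem_ofPred_eq, mem_compl_iff, mem_iUnion, not_iff_not]
    exact ⟨fun H => ⟨H.toFinset, by simp⟩, fun ⟨F, hF⟩ => hF ▸ F.finite_toSet⟩
  have hA : ∀ o, MeasurableSet (A o) := by
    rintro (_ | F)
    · simp only [A, Option.elim_none]
      rw [hcover]
      exact (MeasurableSet.iUnion fun F => measurableSet_genealogy_eq h ν F).compl
    · exact measurableSet_genealogy_eq h ν F
  have hf : ∀ o, Measurable (f o) := by
    rintro (_ | F)
    · exact measurable_const
    · exact measurable_truncatedProduct h ν hu measurable_const _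
  have heq : ∀ o, ∀ p ∈ A o, cascadeProduct h ν u p.1 p.2.1 p.2.2 = f o p := by
    rintro (_ | F) p hp
    · simp only [A, Option.elim_none, mem_ofPred_eq] at hp
      simp [cascadeProduct, hp, f]
    · simp only [A, Option.elim_some, mem_ofPred_eq] at hp
      simp [cascadeProduct, hp, f]
  intro B hB
  have : (fun p : Mode × ℝ × CascadeSpace => cascadeProduct h ν u p.1 p.2.1 p.2.2) ⁻¹' B =
      ⋃ o, A o ∩ f o ⁻¹' B := by
    ext p
    simp only [mem_preimage, mem_iUnion, mem_inter_iff]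
    constructor
    · intro hp
      by_cases hfin : (genealogy h ν p.1 p.2.1 p.2.2).Finite
      · have hpA : p ∈ A (some hfin.toFinset) := by simp [A]
        exact ⟨_, hpA, heq _ p hpA ▸ hp⟩
      · have hpA : p ∈ A none := hfin
        exact ⟨_, hpA, heq _ p hpA ▸ hp⟩
    · rintro ⟨o, ho, hp⟩
      rwa [heq o p ho]
  rw [this]
  exact MeasurableSet.iUnion fun o => (hA o).inter (hf o hB)

theorem measurable_cascadeSolution (h : MajorizingKernel) (ν : ℝ) {u : Mode → CVec}
    (hu : Measurable u) : Measurable fun p : Mode × ℝ => cascadeSolution h ν u p.1 p.2 := by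
  have h1 := h.measurable
  have h2 : StronglyMeasurable fun p : Mode × ℝ =>
      ∫ ω, cascadeProduct h ν u p.1 p.2 ω ∂cascadeMeasure := by
    refine StronglyMeasurable.integral_prod_right' (ν := cascadeMeasure)
      (f := fun q : (Mode × ℝ) × CascadeSpace => cascadeProduct h ν u q.1.1 q.1.2 q.2) ?_
    exact ((measurable_cascadeProduct h ν hu).comp
      (measurable_fst.fst.prodMk (measurable_fst.snd.prodMk measurable_snd))).stronglyMeasurable
  have h3 := h2.measurable
  unfold cascadeSolution
  fun_prop

/-! ### Nondegenerate realizations -/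

/-- The realizations with positive exponential variables and no vanishing frequency: the almost sure
event on which the recursive description of the cascade is meaningful. -/
def IsNondegenerate (h : MajorizingKernel) (ξ : Mode) (ω : CascadeSpace) : Prop :=
  ∀ s, 0 < (ω s).1 ∧ nodeMode h ξ ω s ≠ 0

theorem IsNondegenerate.child {h : MajorizingKernel} {ξ : Mode} {ω : CascadeSpace}
    (H : IsNondegenerate h ξ ω) (b : Bool) : IsNondegenerate h (childMode h ξ ω b) (subtree ω b) :=
  fun s => H (b :: s)

theorem IsNondegenerate.ne_zero {h : MajorizingKernel} {ξ : Mode} {ω : CascadeSpace}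
    (H : IsNondegenerate h ξ ω) : ξ ≠ 0 := (H []).2

theorem IsNondegenerate.holdTime_pos {h : MajorizingKernel} {ν : ℝ} (hν : 0 < ν) {ξ : Mode}
    {ω : CascadeSpace} (H : IsNondegenerate h ξ ω) : 0 < holdTime ν ξ ω := by
  have := H.ne_zero
  have := (H []).1
  unfold holdTime
  positivity

theorem ae_expMeasure_pos {c : ℝ} (hc : 0 < c) : ∀ᵐ x ∂expMeasure c, 0 < x := by
  have := isProbabilityMeasure_expMeasure hc
  have h0 : (expMeasure c).real (Iic 0) = 0 := by
    rw [← cdf_eq_real, cdf_expMeasure_eq hc]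
    simp
  rw [measureReal_eq_zero_iff] at h0
  rw [ae_iff]
  simpa [Iic] using h0

theorem ae_nodeTime_pos (s : List Bool) : ∀ᵐ ω ∂cascadeMeasure, 0 < (ω s).1 := by
  have h1 : ∀ᵐ z ∂nodeLaw, 0 < z.1 :=
    Measure.quasiMeasurePreserving_fst.ae (ae_expMeasure_pos one_pos)
  have h2 : MeasurePreserving (fun ω : CascadeSpace => ω s) cascadeMeasure nodeLaw :=
    measurePreserving_eval_infinitePi (fun _ : List Bool => nodeLaw) s
  exact h2.quasiMeasurePreserving.ae h1

theorem ae_nodeMode_ne_zero (h : MajorizingKernel) (s : List Bool) {ξ : Mode} (hξ : ξ ≠ 0) :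
    ∀ᵐ ω ∂cascadeMeasure, nodeMode h ξ ω s ≠ 0 := by
  induction s generalizing ξ with
  | nil => exact Filter.Eventually.of_forall fun _ => hξ
  | cons b s ih =>
    have hm : MeasurableSet {q : Mode × ℝ × CascadeSpace | nodeMode h q.1 q.2.2 s ≠ 0} :=
      (((measurable_nodeMode h s).comp (measurable_fst.prodMk measurable_snd.snd))
        (measurableSet_singleton 0)).compl
    -- frequencies do not depend on time, so the viscosity and the time are immaterial here
    filter_upwards [ae_child h one_pos (p := fun η _ ω => nodeMode h η ω s ≠ 0) hm
      (fun η hη _ => ih hη) hξ 0] with ω hω using hω b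

theorem ae_isNondegenerate (h : MajorizingKernel) {ξ : Mode} (hξ : ξ ≠ 0) :
    ∀ᵐ ω ∂cascadeMeasure, IsNondegenerate h ξ ω :=
  ae_all_iff.2 fun s => (ae_nodeTime_pos s).and (ae_nodeMode_ne_zero h s hξ)

/-! ### The operation `⊙_ξ` -/

/-- The complexification of the unit vector `e_ξ`. -/
noncomputable def unitDirC (ξ : Mode) : CVec := WithLp.toLp 2 fun i => (unitDir ξ i : ℂ)

theorem norm_unitDirC_le (ξ : Mode) : ‖unitDirC ξ‖ ≤ 1 := by
  have h1 : ‖unitDirC ξ‖ = ‖unitDir ξ‖ := by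
    simp [EuclideanSpace.norm_eq, unitDirC]
  rw [h1, unitDir, norm_smul, norm_inv, norm_norm]
  exact inv_mul_le_one

theorem realDot_unitDir (ξ : Mode) (w : CVec) : realDot (unitDir ξ) w = inner ℂ (unitDirC ξ) w := by
  simp [realDot, unitDirC, PiLp.inner_apply, mul_comm]

theorem perpProj_eq (ξ : Mode) (w : CVec) :
    perpProj ξ w = w - inner ℂ (unitDirC ξ) w • unitDirC ξ := by
  ext i
  simp [perpProj, unitDirC, realDot_unitDir]

theorem norm_perpProj_le (ξ : Mode) (w : CVec) : ‖perpProj ξ w‖ ≤ ‖w‖ := by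
  have h0 := norm_unitDirC_le ξ
  refine le_of_sq_le_sq ?_ (norm_nonneg _)
  set c : ℂ := inner ℂ (unitDirC ξ) w with hc
  have h1 : RCLike.re (inner ℂ w (c • unitDirC ξ)) = ‖c‖ ^ 2 := by
    rw [inner_smul_right, ← inner_conj_symm w, ← hc, RCLike.mul_conj]
    norm_cast
  rw [perpProj_eq, norm_sub_sq (𝕜 := ℂ), ← hc, h1, norm_smul, mul_pow]
  have h2 : ‖unitDirC ξ‖ ^ 2 ≤ 1 := pow_le_one₀ (norm_nonneg _) h0
  nlinarith [sq_nonneg ‖c‖]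

theorem norm_odot_le (ξ : Mode) (a b : CVec) : ‖odot ξ a b‖ ≤ ‖a‖ * ‖b‖ := by
  rw [odot, norm_smul, realDot_unitDir, norm_mul, norm_neg, Complex.norm_I, one_mul, mul_comm]
  refine mul_le_mul (norm_perpProj_le ξ a) ?_ (norm_nonneg _) (norm_nonneg _)
  refine (norm_inner_le_norm _ _).trans ?_
  exact mul_le_of_le_one_left (norm_nonneg _) (norm_unitDirC_le ξ)

/-- The operation `⊙_ξ` as a continuous bilinear map. -/
noncomputable def odotL (ξ : Mode) : CVec →L[ℂ] CVec →L[ℂ] CVec :=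
  LinearMap.mkContinuous₂ (LinearMap.mk₂ ℂ (odot ξ)
    (fun a a' b => by simp only [odot, perpProj_eq, inner_add_right]; module)
    (fun c a b => by simp only [odot, perpProj_eq, inner_smul_right]; module)
    (fun a b b' => by simp only [odot, realDot_unitDir, inner_add_right]; module)
    (fun c a b => by simp only [odot, realDot_unitDir, inner_smul_right]; module)) 1
    fun a b => by simpa using norm_odot_le ξ a b

theorem odotL_apply (ξ : Mode) (a b : CVec) : odotL ξ a b = odot ξ a b := rfl

theorem odot_smul_smul (ξ : Mode) (c d : ℝ) (a b : CVec) :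
    odot ξ (c • a) (d • b) = (c * d) • odot ξ a b := by
  have hc : ∀ (x : ℝ) (y : CVec), x • y = (x : ℂ) • y := fun x y => (Complex.coe_smul x y).symm
  rw [hc c, hc d, hc (c * d), ← odotL_apply, ← odotL_apply, map_smul, map_smul,
    _root_.smul_apply, smul_smul, Complex.ofReal_mul, mul_comm (c : ℂ)]

theorem realDot_smul (ξ : Mode) (c : ℂ) (w : CVec) : realDot ξ (c • w) = c * realDot ξ w := by
  simp only [realDot, PiLp.smul_apply, smul_eq_mul, Finset.mul_sum]
  exact Finset.sum_congr rfl fun i _ => by ring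

theorem realDot_real_smul (ξ : Mode) (c : ℝ) (w : CVec) :
    realDot ξ (c • w) = c * realDot ξ w := by
  rw [← Complex.coe_smul, realDot_smul]

theorem realDot_odot {ξ : Mode} (hξ : ξ ≠ 0) (a b : CVec) : realDot ξ (odot ξ a b) = 0 := by
  have hn : ‖ξ‖ ≠ 0 := norm_ne_zero_iff.2 hξ
  have h1 : ∀ w, realDot ξ w = ‖ξ‖ * realDot (unitDir ξ) w := fun w => by
    simp only [realDot, unitDir, PiLp.smul_apply, smul_eq_mul, Finset.mul_sum]
    refine Finset.sum_congr rfl fun i _ => ?_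
    have : (‖ξ‖ : ℂ) ≠ 0 := Complex.ofReal_ne_zero.2 hn
    push_cast
    field_simp
  have h2 : inner ℂ (unitDirC ξ) (unitDirC ξ) = (1 : ℂ) := by
    rw [inner_self_eq_norm_sq_to_K]
    have : ‖unitDirC ξ‖ = ‖unitDir ξ‖ := by simp [EuclideanSpace.norm_eq, unitDirC]
    rw [this, unitDir, norm_smul, norm_inv, norm_norm, inv_mul_cancel₀ hn]
    simp
  rw [odot, realDot_smul, h1, realDot_unitDir, realDot_unitDir, perpProj_eq, inner_sub_right, inner_smul_right, h2]
  simp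

/-! ### Genealogical trees -/

section genealogy

variable {h : MajorizingKernel} {ν : ℝ} {ξ : Mode} {ω : CascadeSpace} {t : ℝ}

theorem cons_mem_genealogy (b : Bool) (s : List Bool) :
    b :: s ∈ genealogy h ν ξ t ω ↔
      s ∈ genealogy h ν (childMode h ξ ω b) (t - holdTime ν ξ ω) (subtree ω b) := by
  simp only [genealogy, mem_ofPred_eq, birthTime]
  exact le_sub_iff_add_le'.symm

theorem nil_mem_genealogy : [] ∈ genealogy h ν ξ t ω ↔ 0 ≤ t := Iff.rfl

theorem finite_genealogy_child (hfin : (genealogy h ν ξ t ω).Finite) (b : Bool) :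
    (genealogy h ν (childMode h ξ ω b) (t - holdTime ν ξ ω) (subtree ω b)).Finite := by
  refine (hfin.preimage (f := (b :: ·)) fun x _ y _ hxy => by simpa using hxy).subset fun s hs => ?_
  exact (cons_mem_genealogy b s).2 hs

theorem birthTime_nonneg (hν : 0 < ν) (H : IsNondegenerate h ξ ω) (s : List Bool) :
    0 ≤ birthTime h ν ξ ω s := by
  induction s generalizing ξ ω with
  | nil => exact le_rfl
  | cons b s ih => exact add_nonneg (H.holdTime_pos hν).le (ih (H.child b))

theorem birthTime_take_le (hν : 0 < ν) (H : IsNondegenerate h ξ ω) (s : List Bool) (j : ℕ) :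
    birthTime h ν ξ ω (s.take j) ≤ birthTime h ν ξ ω s := by
  induction s generalizing ξ ω j with
  | nil => simp
  | cons b s ih =>
    cases j with
    | zero => exact birthTime_nonneg hν H _
    | succ j => exact add_le_add_right (ih (H.child b) j) _

/-- The words of a finite genealogical tree are shorter than its number of elements, since the tree
contains all their prefixes. -/
theorem length_lt_ncard_genealogy (hν : 0 < ν) (H : IsNondegenerate h ξ ω)
    (hfin : (genealogy h ν ξ t ω).Finite) {s : List Bool} (hs : s ∈ genealogy h ν ξ t ω) :
    s.length < (genealogy h ν ξ t ω).ncard := by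
  classical
  have hsub : (((Finset.range (s.length + 1)).image fun j => s.take j : Finset (List Bool)) :
      Set (List Bool)) ⊆ genealogy h ν ξ t ω := by
    intro u hu
    simp only [Finset.coe_image, mem_image] at hu
    obtain ⟨j, _, rfl⟩ := hu
    exact (birthTime_take_le hν H s j).trans hs
  have hcard := Set.ncard_le_ncard hsub hfin
  rw [Set.ncard_coe_finset, Finset.card_image_of_injOn, Finset.card_range] at hcard
  · exact hcard
  · intro i hi j hj hij
    have := congrArg List.length hij
    simp only [Finset.coe_range, mem_Iio] at hi hj
    simp only [List.length_take] at this
    omega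

theorem truncatedProduct_of_lt {u : Mode → CVec} {v : Mode → ℝ → CVec} {n : ℕ}
    (ht : t < holdTime ν ξ ω) :
    truncatedProduct h ν u v (n + 1) ξ t ω = (h ξ)⁻¹ • u ξ := by
  rw [truncatedProduct, if_pos ht]

theorem truncatedProduct_of_le {u : Mode → CVec} {v : Mode → ℝ → CVec} {n : ℕ}
    (ht : holdTime ν ξ ω ≤ t) :
    truncatedProduct h ν u v (n + 1) ξ t ω = branchFactor h ν ξ • odot ξ
      (truncatedProduct h ν u v n (childMode h ξ ω false) (t - holdTime ν ξ ω) (subtree ω false))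
      (truncatedProduct h ν u v n (childMode h ξ ω true) (t - holdTime ν ξ ω)
        (subtree ω true)) := by
  rw [truncatedProduct, if_neg ht.not_gt]

/-- Cutting off beyond the last generation of the genealogical tree has no effect. -/
theorem truncatedProduct_eq_of_length_lt {u : Mode → CVec} (v v' : Mode → ℝ → CVec) {n n' : ℕ}
    (hn : n ≤ n') (ht : 0 ≤ t) (H : ∀ s ∈ genealogy h ν ξ t ω, s.length < n) :
    truncatedProduct h ν u v n ξ t ω = truncatedProduct h ν u v' n' ξ t ω := by
  induction n generalizing n' ξ t ω with
  | zero => exact absurd (H [] ht) (by simp)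
  | succ n ih =>
    obtain ⟨k, rfl⟩ := Nat.exists_eq_add_of_le' hn
    rw [← add_assoc k n 1]
    rcases lt_or_ge t (holdTime ν ξ ω) with hlt | hle
    · rw [truncatedProduct_of_lt hlt, truncatedProduct_of_lt hlt]
    · have key : ∀ b, truncatedProduct h ν u v n (childMode h ξ ω b) (t - holdTime ν ξ ω)
          (subtree ω b) = truncatedProduct h ν u v' (k + n) (childMode h ξ ω b)
          (t - holdTime ν ξ ω) (subtree ω b) := fun b =>
        ih (Nat.le_add_left n k) (sub_nonneg.2 hle) fun s hs => by
          simpa using H (b :: s) ((cons_mem_genealogy b s).2 hs)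
      rw [truncatedProduct_of_le hle, truncatedProduct_of_le hle, key, key]

theorem truncatedProduct_eq_cascadeProduct (hν : 0 < ν) (H : IsNondegenerate h ξ ω)
    (hfin : (genealogy h ν ξ t ω).Finite) (ht : 0 ≤ t) (u : Mode → CVec) (v : Mode → ℝ → CVec)
    {n : ℕ} (hn : (genealogy h ν ξ t ω).ncard ≤ n) :
    truncatedProduct h ν u v n ξ t ω = cascadeProduct h ν u ξ t ω := by
  rw [cascadeProduct, if_pos hfin]
  exact (truncatedProduct_eq_of_length_lt _ _ hn ht fun s hs =>
    length_lt_ncard_genealogy hν H hfin hs).symm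

theorem cascadeProduct_eq_ite (hν : 0 < ν) (H : IsNondegenerate h ξ ω)
    (hfin : (genealogy h ν ξ t ω).Finite) (ht : 0 ≤ t) (u : Mode → CVec) :
    cascadeProduct h ν u ξ t ω = if t < holdTime ν ξ ω then (h ξ)⁻¹ • u ξ
      else branchFactor h ν ξ • odot ξ
        (cascadeProduct h ν u (childMode h ξ ω false) (t - holdTime ν ξ ω) (subtree ω false))
        (cascadeProduct h ν u (childMode h ξ ω true) (t - holdTime ν ξ ω) (subtree ω true)) := by
  have hc := finite_genealogy_child hfin
  let N : ℕ := (genealogy h ν ξ t ω).ncard +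
    ((genealogy h ν (childMode h ξ ω false) (t - holdTime ν ξ ω) (subtree ω false)).ncard +
    (genealogy h ν (childMode h ξ ω true) (t - holdTime ν ξ ω) (subtree ω true)).ncard)
  rw [← truncatedProduct_eq_cascadeProduct hν H hfin ht u (fun _ _ => 0) (n := N + 1) (by omega),
    truncatedProduct]
  split_ifs with hlt
  · rfl
  · have h0 : 0 ≤ t - holdTime ν ξ ω := sub_nonneg.2 (not_lt.1 hlt)
    rw [truncatedProduct_eq_cascadeProduct hν (H.child false) (hc false) h0 _ _ (by omega),
      truncatedProduct_eq_cascadeProduct hν (H.child true) (hc true) h0 _ _ (by omega)]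

theorem truncatedProduct_congr {T : ℝ} (hν : 0 < ν) {u u' : Mode → CVec} {v v' : Mode → ℝ → CVec}
    (hu : ∀ η, η ≠ 0 → u η = u' η) (hv : ∀ η, η ≠ 0 → ∀ r ∈ Icc 0 T, v η r = v' η r)
    (H : IsNondegenerate h ξ ω) (ht : t ∈ Icc 0 T) (n : ℕ) :
    truncatedProduct h ν u v n ξ t ω = truncatedProduct h ν u' v' n ξ t ω := by
  induction n generalizing ξ t ω with
  | zero => rw [truncatedProduct, truncatedProduct, hv ξ H.ne_zero t ht]
  | succ n ih =>
    rcases lt_or_ge t (holdTime ν ξ ω) with hlt | hle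
    · rw [truncatedProduct_of_lt hlt, truncatedProduct_of_lt hlt, hu ξ H.ne_zero]
    · have h0 : t - holdTime ν ξ ω ∈ Icc 0 T :=
        ⟨sub_nonneg.2 hle, by linarith [ht.2, H.holdTime_pos hν]⟩
      rw [truncatedProduct_of_le hle, truncatedProduct_of_le hle, ih (H.child false) h0,
        ih (H.child true) h0]

theorem realDot_truncatedProduct {u : Mode → CVec} (hu : ∀ η, realDot η (u η) = 0)
    (hξ : ξ ≠ 0) (n : ℕ) :
    realDot ξ (truncatedProduct h ν u (fun _ _ => 0) n ξ t ω) = 0 := by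
  cases n with
  | zero => simp [truncatedProduct, realDot]
  | succ n =>
    rw [truncatedProduct]
    split_ifs
    · rw [realDot_real_smul, hu, mul_zero]
    · rw [realDot_real_smul, realDot_odot hξ, mul_zero]

theorem realDot_cascadeProduct {u : Mode → CVec} (hu : ∀ η, realDot η (u η) = 0) (hξ : ξ ≠ 0) :
    realDot ξ (cascadeProduct h ν u ξ t ω) = 0 := by
  rw [cascadeProduct]
  split_ifs
  · exact realDot_truncatedProduct hu hξ _
  · simp [realDot]

/-! ### Finiteness of the genealogical tree -/

theorem birthTime_eq_sum (s : List Bool) :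
    birthTime h ν ξ ω s = ∑ j ∈ Finset.range s.length,
      (ω (s.take j)).1 / (ν * ‖nodeMode h ξ ω (s.take j)‖ ^ 2) := by
  induction s generalizing ξ ω with
  | nil => simp [birthTime]
  | cons b s ih =>
    rw [birthTime, ih, List.length_cons, Finset.sum_range_succ', add_comm]
    rfl

/-- A particle of generation `> n` is born after time `ζ_n / ν`. -/
theorem explosionTimeAt_le (hν : 0 < ν) (H : IsNondegenerate h ξ ω) {n : ℕ} {s : List Bool}
    (hs : n < s.length) :
    explosionTimeAt h n ξ ω ≤ ENNReal.ofReal (ν * birthTime h ν ξ ω s) := by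
  have hpos : ∀ u, 0 ≤ (‖nodeMode h ξ ω u‖ ^ 2)⁻¹ * (ω u).1 := fun u =>
    mul_nonneg (by positivity) (H u).1.le
  have hlen : (s.take n).length = n := by simp [hs.le]
  calc explosionTimeAt h n ξ ω
      ≤ ∑ j ∈ Finset.Icc 1 n, ENNReal.ofReal
          ((‖nodeMode h ξ ω ((s.take n).take j)‖ ^ 2)⁻¹ * (ω ((s.take n).take j)).1) :=
        iInf₂_le (s.take n) hlen
    _ = ∑ j ∈ Finset.Icc 1 n, ENNReal.ofReal
          ((‖nodeMode h ξ ω (s.take j)‖ ^ 2)⁻¹ * (ω (s.take j)).1) := by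
        refine Finset.sum_congr rfl fun j hj => ?_
        rw [List.take_take, min_eq_left (Finset.mem_Icc.1 hj).2]
    _ ≤ ∑ j ∈ Finset.range s.length, ENNReal.ofReal
          ((‖nodeMode h ξ ω (s.take j)‖ ^ 2)⁻¹ * (ω (s.take j)).1) := by
        refine Finset.sum_le_sum_of_subset fun j hj => ?_
        simp only [Finset.mem_Icc, Finset.mem_range] at hj ⊢
        omega
    _ = ENNReal.ofReal (ν * birthTime h ν ξ ω s) := by
        rw [← ENNReal.ofReal_sum_of_nonneg fun j _ => hpos _, birthTime_eq_sum, Finset.mul_sum]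
        congr 1
        refine Finset.sum_congr rfl fun j _ => ?_
        have := (H (s.take j)).2
        field_simp

theorem finite_genealogy (hν : 0 < ν) (H : IsNondegenerate h ξ ω)
    (hζ : explosionTime h ξ ω = ⊤) (t : ℝ) : (genealogy h ν ξ t ω).Finite := by
  obtain ⟨n, hn⟩ : ∃ n, ENNReal.ofReal (ν * t) < explosionTimeAt h n ξ ω :=
    lt_iSup_iff.1 (show _ < explosionTime h ξ ω from hζ ▸ ENNReal.ofReal_lt_top)
  refine (List.finite_length_le Bool n).subset fun s hs => ?_
  by_contra hlen
  refine absurd (explosionTimeAt_le hν H (not_le.1 hlen)) (not_le.2 (lt_of_le_of_lt ?_ hn))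
  exact ENNReal.ofReal_le_ofReal (mul_le_mul_of_nonneg_left hs hν.le)

end genealogy

theorem ae_finite_genealogy {ν : ℝ} (hν : 0 < ν) {h : MajorizingKernel} (h_ne : NonExplosive h)
    {ξ : Mode} (hξ : ξ ≠ 0) (t : ℝ) : ∀ᵐ ω ∂cascadeMeasure, (genealogy h ν ξ t ω).Finite := by
  have h1 : ∀ᵐ ω ∂cascadeMeasure, ¬ explosionTime h ξ ω < ⊤ := by
    rw [ae_iff]
    simpa only [not_not] using h_ne ξ hξ
  filter_upwards [h1, ae_isNondegenerate h hξ] with ω h1 h2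
  exact finite_genealogy hν h2 (not_lt_top_iff.1 h1) t

/-! ### Conditioning on the first branching -/

/-- The joint density of the holding time and the first offspring frequency of a particle of
frequency `ξ`. -/
noncomputable def stepDensity (h : MajorizingKernel) (ν : ℝ) (ξ : Mode) (p : ℝ × Mode) : ENNReal :=
  exponentialPDF (ν * ‖ξ‖ ^ 2) p.1 * branchDensity h ξ p.2

theorem measurable_stepDensity (h : MajorizingKernel) (ν : ℝ) (ξ : Mode) :
    Measurable (stepDensity h ν ξ) := by
  have h1 : Measurable (exponentialPDF (ν * ‖ξ‖ ^ 2)) :=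
    (measurable_exponentialPDFReal _).ennreal_ofReal
  have h2 : Measurable (branchDensity h ξ) := (measurable_branchDensity h).of_uncurry_left
  exact (h1.comp measurable_fst).mul (h2.comp measurable_snd)

theorem stepDensity_lt_top (h : MajorizingKernel) (ν : ℝ) (ξ : Mode) (p : ℝ × Mode) :
    stepDensity h ν ξ p < ⊤ := by
  refine ENNReal.mul_lt_top ENNReal.ofReal_lt_top (ENNReal.div_lt_top ?_ (selfConv_pos h ξ))
  exact ENNReal.mul_ne_top ENNReal.ofReal_ne_top ENNReal.ofReal_ne_top

theorem expMeasure_prod_branchLaw (h : MajorizingKernel) (ν : ℝ) (ξ : Mode) :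
    (expMeasure (ν * ‖ξ‖ ^ 2)).prod (branchLaw h ξ) =
      ((volume : Measure ℝ).prod (volume : Measure Mode)).withDensity (stepDensity h ν ξ) :=
  prod_withDensity (measurable_exponentialPDFReal _).ennreal_ofReal
    (measurable_branchDensity h).of_uncurry_left

/-- The factors in the cascade product are chosen so that, weighted by the law of the first
branching, they reproduce the integrand of the mild formulation. -/
theorem stepDensity_smul_odot (h : MajorizingKernel) {ν : ℝ} (hν : 0 < ν) {ξ : Mode} (hξ : ξ ≠ 0)
    (w : Mode → ℝ → CVec) {s t : ℝ} (hs : 0 ≤ s) {η : Mode} (hη : η ≠ 0) (hη' : ξ - η ≠ 0) :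
    (stepDensity h ν ξ (s, η)).toReal •
        (branchFactor h ν ξ • odot ξ (w η (t - s)) (w (ξ - η) (t - s))) =
      (h ξ)⁻¹ • mildIntegrand ν (fun η r => h η • w η r) ξ t s η := by
  have h1 := h.pos ξ hξ
  have h2 := h.pos η hη
  have h3 := h.pos _ hη'
  have hn : 0 < ‖ξ‖ := norm_pos_iff.2 hξ
  have hC : 0 < (selfConv h ξ).toReal :=
    ENNReal.toReal_pos (selfConv_pos h ξ) (h.conv_lt_top ξ hξ).ne
  have hk : 0 < (2 * Real.pi) ^ (3 / 2 : ℝ) := by positivity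
  have hD : (stepDensity h ν ξ (s, η)).toReal =
      ν * ‖ξ‖ ^ 2 * Real.exp (-(ν * ‖ξ‖ ^ 2 * s)) * (h η * h (ξ - η) / (selfConv h ξ).toReal) := by
    rw [stepDensity, exponentialPDF_of_nonneg hs, branchDensity, ENNReal.toReal_mul,
      ENNReal.toReal_ofReal (by positivity), ENNReal.toReal_div, ENNReal.toReal_mul,
      ENNReal.toReal_ofReal h2.le, ENNReal.toReal_ofReal h3.le]
  rw [hD, mildIntegrand, odot_smul_smul, smul_smul, smul_smul, smul_smul, branchFactor]
  congr 1
  rw [show -ν * ‖ξ‖ ^ 2 * s = -(ν * ‖ξ‖ ^ 2 * s) by ring]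
  field_simp

theorem measureReal_lt_holdTime (h : MajorizingKernel) {ν : ℝ} (hν : 0 < ν) {ξ : Mode} (hξ : ξ ≠ 0)
    {t : ℝ} (ht : 0 ≤ t) :
    cascadeMeasure.real {ω | t < holdTime ν ξ ω} = Real.exp (-ν * ‖ξ‖ ^ 2 * t) := by
  have hc : 0 < ν * ‖ξ‖ ^ 2 := by positivity
  have := isProbabilityMeasure_expMeasure hc
  have := isProbabilityMeasure_branchLaw h hξ
  have hm : Measurable (holdTime ν ξ) := (measurable_holdTime ν).of_uncurry_left
  have hG : Measurable (sampler h ξ) := (measurable_sampler h).of_uncurry_left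
  have hF : Measurable (fun ω : CascadeSpace => ((holdTime ν ξ ω, sampler h ξ (ω []).2),
      (subtree ω false, subtree ω true))) :=
    (hm.prodMk (hG.comp (measurable_pi_apply []).snd)).prodMk
      ((measurable_subtree false).prodMk (measurable_subtree true))
  have hlaw : cascadeMeasure.map (holdTime ν ξ) = expMeasure (ν * ‖ξ‖ ^ 2) := by
    have e : holdTime ν ξ = (fun z : (ℝ × Mode) × CascadeSpace × CascadeSpace => z.1.1) ∘
      (fun ω : CascadeSpace => ((holdTime ν ξ ω, sampler h ξ (ω []).2),
        (subtree ω false, subtree ω true))) := rfl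
    rw [e, ← Measure.map_map measurable_fst.fst hF, map_firstStep_holdTime h hν hξ,
      show (fun z : (ℝ × Mode) × CascadeSpace × CascadeSpace => z.1.1) = Prod.fst ∘ Prod.fst
        from rfl, ← Measure.map_map measurable_fst measurable_fst, Measure.map_fst_prod,
      measure_univ, one_smul, Measure.map_fst_prod, measure_univ, one_smul]
  have e1 : {ω | t < holdTime ν ξ ω} = holdTime ν ξ ⁻¹' (Iic t)ᶜ := by
    ext ω
    simp
  rw [e1, ← map_measureReal_apply hm measurableSet_Iic.compl, hlaw,
    probReal_compl_eq_one_sub measurableSet_Iic, ← cdf_eq_real, cdf_expMeasure_eq hc, if_pos ht]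
  simp

theorem integrable_prod_odot {α β : Type*} [MeasurableSpace α] [MeasurableSpace β]
    {μ : Measure α} {μ' : Measure β} {f : α → CVec} {g : β → CVec} (ξ : Mode)
    (hf : Integrable f μ) (hg : Integrable g μ') :
    Integrable (fun z => odot ξ (f z.1) (g z.2)) (μ.prod μ') := by
  have h1 : Continuous (Function.uncurry fun a b => odotL ξ a b) := by
    unfold Function.uncurry
    fun_prop
  exact hf.op_fst_snd (op := fun a b => odotL ξ a b) h1 ⟨‖odotL ξ‖, (odotL ξ).le_opNorm₂⟩ hg

theorem integral_prod_odot {α β : Type*} [MeasurableSpace α] [MeasurableSpace β]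
    {μ : Measure α} {μ' : Measure β} [SFinite μ] [SFinite μ'] {f : α → CVec} {g : β → CVec}
    (ξ : Mode) (hf : Integrable f μ) (hg : Integrable g μ') :
    ∫ z, odot ξ (f z.1) (g z.2) ∂μ.prod μ' = odot ξ (∫ x, f x ∂μ) (∫ y, g y ∂μ') :=
  integral_prod_bilin (odotL ξ) hf hg

/-- If `Z` is obtained from a family `F` of cascade functionals by one step of the recursion that
defines cascade products, then `h E Z` is given by the right-hand side of the mild formulation for
the function `h E F`. -/
theorem mild_of_step (h : MajorizingKernel) {ν T : ℝ} (hν : 0 < ν) {F : Mode → ℝ → CascadeSpace → CVec}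
    (hF : Measurable fun p : Mode × ℝ × CascadeSpace => F p.1 p.2.1 p.2.2)
    (hint : ∀ η, η ≠ 0 → ∀ r ∈ Icc 0 T, Integrable (F η r) cascadeMeasure) {ξ : Mode} (hξ : ξ ≠ 0)
    {t : ℝ} (ht : t ∈ Icc 0 T) (a : CVec)
    (hZ : Integrable (fun ω => if t < holdTime ν ξ ω then (h ξ)⁻¹ • a else
      branchFactor h ν ξ • odot ξ
        (F (childMode h ξ ω false) (t - holdTime ν ξ ω) (subtree ω false))
        (F (childMode h ξ ω true) (t - holdTime ν ξ ω) (subtree ω true))) cascadeMeasure) :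
    Integrable (fun p : ℝ × Mode =>
        mildIntegrand ν (fun η r => h η • ∫ ω, F η r ω ∂cascadeMeasure) ξ t p.1 p.2)
      ((volume.restrict (Ioc 0 t)).prod volume) ∧
    h ξ • ∫ ω, (if t < holdTime ν ξ ω then (h ξ)⁻¹ • a else
      branchFactor h ν ξ • odot ξ
        (F (childMode h ξ ω false) (t - holdTime ν ξ ω) (subtree ω false))
        (F (childMode h ξ ω true) (t - holdTime ν ξ ω) (subtree ω true))) ∂cascadeMeasure =
      Real.exp (-ν * ‖ξ‖ ^ 2 * t) • a + ∫ s in (0 : ℝ)..t, ∫ η : Mode,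
        mildIntegrand ν (fun η r => h η • ∫ ω, F η r ω ∂cascadeMeasure) ξ t s η := by
  have hc : 0 < ν * ‖ξ‖ ^ 2 := by positivity
  have := isProbabilityMeasure_expMeasure hc
  have := isProbabilityMeasure_branchLaw h hξ
  have hh := h.pos ξ hξ
  have hm : Measurable (holdTime ν ξ) := (measurable_holdTime ν).of_uncurry_left
  have hG : Measurable (sampler h ξ) := (measurable_sampler h).of_uncurry_left
  set w : Mode → ℝ → CVec := fun η r => ∫ ω, F η r ω ∂cascadeMeasure with hw
  set S : CascadeSpace → (ℝ × Mode) × CascadeSpace × CascadeSpace := fun ω =>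
    ((holdTime ν ξ ω, sampler h ξ (ω []).2), (subtree ω false, subtree ω true)) with hS
  have hSm : Measurable S :=
    (hm.prodMk (hG.comp (measurable_pi_apply []).snd)).prodMk
      ((measurable_subtree false).prodMk (measurable_subtree true))
  set μ := (expMeasure (ν * ‖ξ‖ ^ 2)).prod (branchLaw h ξ) with hμ
  have hlaw : cascadeMeasure.map S = μ.prod (cascadeMeasure.prod cascadeMeasure) :=
    map_firstStep_holdTime h hν hξ
  -- the contribution of the event that the root branches before time `t`
  set g : (ℝ × Mode) × CascadeSpace × CascadeSpace → CVec := fun z =>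
    if t < z.1.1 then 0 else branchFactor h ν ξ • odot ξ (F z.1.2 (t - z.1.1) z.2.1)
      (F (ξ - z.1.2) (t - z.1.1) z.2.2) with hg
  have hgm : Measurable g := by
    have h1 : Measurable fun z : (ℝ × Mode) × CascadeSpace × CascadeSpace =>
        F z.1.2 (t - z.1.1) z.2.1 := by
      have : Measurable fun z : (ℝ × Mode) × CascadeSpace × CascadeSpace =>
        (z.1.2, t - z.1.1, z.2.1) := by fun_prop
      exact hF.comp this
    have h2 : Measurable fun z : (ℝ × Mode) × CascadeSpace × CascadeSpace =>
        F (ξ - z.1.2) (t - z.1.1) z.2.2 := by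
      have : Measurable fun z : (ℝ × Mode) × CascadeSpace × CascadeSpace =>
        (ξ - z.1.2, t - z.1.1, z.2.2) := by fun_prop
      exact hF.comp this
    have h3 : Measurable fun z : (ℝ × Mode) × CascadeSpace × CascadeSpace =>
        branchFactor h ν ξ • odot ξ (F z.1.2 (t - z.1.1) z.2.1) (F (ξ - z.1.2) (t - z.1.1) z.2.2) :=
      (Measurable.odot measurable_const h1 h2).const_smul (branchFactor h ν ξ)
    exact Measurable.ite (measurableSet_lt measurable_const measurable_fst.fst) measurable_const h3
  have hA : MeasurableSet {ω | t < holdTime ν ξ ω} := measurableSet_lt measurable_const hm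
  have hsplit : (fun ω => if t < holdTime ν ξ ω then (h ξ)⁻¹ • a else
      branchFactor h ν ξ • odot ξ
        (F (childMode h ξ ω false) (t - holdTime ν ξ ω) (subtree ω false))
        (F (childMode h ξ ω true) (t - holdTime ν ξ ω) (subtree ω true))) =
      fun ω => {ω | t < holdTime ν ξ ω}.indicator (fun _ => (h ξ)⁻¹ • a) ω + g (S ω) := by
    funext ω
    by_cases hlt : t < holdTime ν ξ ω <;> simp [hg, hS, hlt, childMode]
  rw [hsplit] at hZ ⊢
  have hI1 : Integrable ({ω | t < holdTime ν ξ ω}.indicator fun _ => (h ξ)⁻¹ • a)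
      cascadeMeasure := (integrable_const _).indicator hA
  have hI2 : Integrable (fun ω => g (S ω)) cascadeMeasure := by
    refine (hZ.sub hI1).congr (Filter.Eventually.of_forall fun ω => ?_)
    simp
  have hg1 : Integrable g (μ.prod (cascadeMeasure.prod cascadeMeasure)) := by
    rw [← hlaw]
    exact (integrable_map_measure hgm.aestronglyMeasurable hSm.aemeasurable).2 hI2
  -- the two subtrees are independent, so their expectations multiply
  have hinner : ∀ s ≥ 0, ∀ η, η ≠ 0 → ξ - η ≠ 0 →
      ∫ q, g ((s, η), q) ∂cascadeMeasure.prod cascadeMeasure =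
      if t < s then 0 else branchFactor h ν ξ • odot ξ (w η (t - s)) (w (ξ - η) (t - s)) := by
    intro s hs η hη hη'
    simp only [hg]
    split_ifs with hlt
    · simp
    · have hr : t - s ∈ Icc 0 T := ⟨by linarith, by linarith [ht.2]⟩
      rw [integral_smul]
      congr 1
      exact integral_prod_odot ξ (hint η hη _ hr) (hint _ hη' _ hr)
  set f : Mode → ℝ → CVec := fun η r => h η • w η r with hf
  have hΦ : (fun p : ℝ × Mode => (stepDensity h ν ξ p).toReal •
        ∫ q, g (p, q) ∂cascadeMeasure.prod cascadeMeasure) =ᵐ[volume.prod volume]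
      fun p => (h ξ)⁻¹ • (Ioc 0 t ×ˢ univ).indicator
        (fun p : ℝ × Mode => mildIntegrand ν f ξ t p.1 p.2) p := by
    have e1 : ∀ᵐ p : ℝ × Mode ∂(volume.prod volume), p.1 ≠ 0 :=
      Measure.quasiMeasurePreserving_fst.ae (by
        simpa using (measure_eq_zero_iff_ae_notMem (μ := (volume : Measure ℝ))).1
          (measure_singleton (0 : ℝ)))
    have e2 : ∀ᵐ p : ℝ × Mode ∂(volume.prod volume), p.2 ≠ 0 ∧ p.2 ≠ ξ :=
      Measure.quasiMeasurePreserving_snd.ae ((ae_ne_volume 0).and (ae_ne_volume ξ))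
    filter_upwards [e1, e2] with ⟨s, η⟩ hs hη
    have hη' : ξ - η ≠ 0 := sub_ne_zero.2 (Ne.symm hη.2)
    rcases lt_or_gt_of_ne hs with hneg | hpos
    · have : (s, η) ∉ Ioc 0 t ×ˢ (univ : Set Mode) := by
        simp only [mem_prod, mem_Ioc, mem_univ, and_true, not_and]
        intro h0
        exact absurd h0 hneg.le.not_gt
      rw [indicator_of_notMem this, stepDensity, exponentialPDF_of_neg hneg]
      simp
    · rw [hinner s hpos.le η hη.1 hη']
      by_cases hlt : t < s
      · have : (s, η) ∉ Ioc 0 t ×ˢ (univ : Set Mode) := by simp [hlt]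
        rw [indicator_of_notMem this, if_pos hlt]
        simp
      · have : (s, η) ∈ Ioc 0 t ×ˢ (univ : Set Mode) := by
          simpa using ⟨hpos, not_lt.1 hlt⟩
        rw [indicator_of_mem this, if_neg hlt]
        exact stepDensity_smul_odot h hν hξ w hpos.le hη.1 hη'
  have hset : MeasurableSet (Ioc 0 t ×ˢ (univ : Set Mode)) := measurableSet_Ioc.prod .univ
  have hres : ((volume : Measure ℝ).prod (volume : Measure Mode)).restrict (Ioc 0 t ×ˢ univ) =
      (volume.restrict (Ioc 0 t)).prod volume := by
    rw [← Measure.prod_restrict, Measure.restrict_univ]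
  have hfin : ∀ᵐ p ∂((volume : Measure ℝ).prod (volume : Measure Mode)),
      stepDensity h ν ξ p < ⊤ := Filter.Eventually.of_forall (stepDensity_lt_top h ν ξ)
  have hmild : Integrable (fun p : ℝ × Mode => mildIntegrand ν f ξ t p.1 p.2)
      ((volume.restrict (Ioc 0 t)).prod volume) := by
    have i1 := hg1.integral_prod_left
    rw [hμ, expMeasure_prod_branchLaw, integrable_withDensity_iff_integrable_smul'
      (measurable_stepDensity h ν ξ) hfin, integrable_congr hΦ] at i1
    rw [← hres]
    refine (integrable_indicator_iff hset).1 ?_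
    refine (i1.smul (h ξ)).congr (Filter.Eventually.of_forall fun p => ?_)
    exact smul_inv_smul₀ hh.ne' _
  refine ⟨hmild, ?_⟩
  rw [integral_add hI1 hI2, smul_add, integral_indicator_const _ hA,
    measureReal_lt_holdTime h hν hξ ht.1, smul_comm, smul_inv_smul₀ hh.ne']
  congr 1
  rw [intervalIntegral.integral_of_le ht.1, ← integral_prod _ hmild, ← hres,
    ← integral_indicator hset, ← integral_map hSm.aemeasurable hgm.aestronglyMeasurable, hlaw,
    integral_prod _ hg1, hμ, expMeasure_prod_branchLaw,
    integral_withDensity_eq_integral_toReal_smul (measurable_stepDensity h ν ξ) hfin,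
    integral_congr_ae hΦ, integral_smul, smul_inv_smul₀ hh.ne']

/-! ### The cascade solution -/

section solution

variable {h : MajorizingKernel} {ν T : ℝ} {u : Mode → CVec}

theorem ae_cascadeProduct_eq_ite (hν : 0 < ν) (h_ne : NonExplosive h) (u : Mode → CVec) {ξ : Mode}
    (hξ : ξ ≠ 0) {t : ℝ} (ht : 0 ≤ t) : ∀ᵐ ω ∂cascadeMeasure,
    cascadeProduct h ν u ξ t ω = if t < holdTime ν ξ ω then (h ξ)⁻¹ • u ξ
      else branchFactor h ν ξ • odot ξ
        (cascadeProduct h ν u (childMode h ξ ω false) (t - holdTime ν ξ ω) (subtree ω false))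
        (cascadeProduct h ν u (childMode h ξ ω true) (t - holdTime ν ξ ω) (subtree ω true)) := by
  filter_upwards [ae_finite_genealogy hν h_ne hξ t, ae_isNondegenerate h hξ] with ω h1 h2
  exact cascadeProduct_eq_ite hν h2 h1 ht u

theorem cascadeSolution_zero (hν : 0 < ν) (h_ne : NonExplosive h) (u : Mode → CVec) {ξ : Mode}
    (hξ : ξ ≠ 0) : cascadeSolution h ν u ξ 0 = u ξ := by
  have e : ∀ᵐ ω ∂cascadeMeasure, cascadeProduct h ν u ξ 0 ω = (h ξ)⁻¹ • u ξ := by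
    filter_upwards [ae_cascadeProduct_eq_ite hν h_ne u hξ le_rfl, ae_isNondegenerate h hξ] with
      ω h1 h2
    rw [h1, if_pos (h2.holdTime_pos hν)]
  rw [cascadeSolution, integral_congr_ae e, integral_const, probReal_univ, one_smul,
    smul_inv_smul₀ (h.pos ξ hξ).ne']

theorem isMildSolution_cascadeSolution (hν : 0 < ν) (h_ne : NonExplosive h) (hu : Measurable u)
    (hex : CascadeExpectationExists h ν T u) :
    IsMildSolution ν T u (cascadeSolution h ν u) := by
  have key : ∀ ξ : Mode, ξ ≠ 0 → ∀ t ∈ Icc 0 T, _ := fun ξ hξ t ht =>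
    mild_of_step h hν (measurable_cascadeProduct h ν hu) hex hξ ht (u ξ)
      ((hex ξ hξ t ht).congr (ae_cascadeProduct_eq_ite hν h_ne u hξ ht.1))
  refine ⟨?_, fun ξ hξ t ht => (key ξ hξ t ht).1, fun ξ hξ t ht => ?_⟩
  · exact (measurable_cascadeSolution h ν hu).comp
      (measurable_fst.prodMk (measurable_subtype_coe.comp measurable_snd))
  · rw [cascadeSolution, integral_congr_ae (ae_cascadeProduct_eq_ite hν h_ne u hξ ht.1)]
    exact (key ξ hξ t ht).2

theorem realDot_cascadeSolution (hdiv : ∀ ξ : Mode, realDot ξ (u ξ) = 0) {ξ : Mode} (hξ : ξ ≠ 0)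
    {t : ℝ} (hint : Integrable (cascadeProduct h ν u ξ t) cascadeMeasure) :
    realDot ξ (cascadeSolution h ν u ξ t) = 0 := by
  let ξc : CVec := WithLp.toLp 2 fun i => (ξ i : ℂ)
  have e : ∀ w, realDot ξ w = innerSL ℂ ξc w := fun w => by
    simp [realDot, ξc, PiLp.inner_apply, mul_comm]
  rw [cascadeSolution, realDot_real_smul, e, ← ContinuousLinearMap.integral_comp_comm _ hint]
  simp [← e, realDot_cascadeProduct hdiv hξ]

/-- Averaging the cascade product over the variables in the generations `≥ n` gives the product cut
off at generation `n`, with the cascade solution as terminal value. -/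
theorem ae_integral_cascadeProduct_resample (hν : 0 < ν) (h_ne : NonExplosive h)
    (hu : Measurable u) (hex : CascadeExpectationExists h ν T u) (n : ℕ) {ξ : Mode} (hξ : ξ ≠ 0)
    {t : ℝ} (ht : t ∈ Icc 0 T) : ∀ᵐ ω ∂cascadeMeasure,
    Integrable (fun ω' => cascadeProduct h ν u ξ t (resample n (ω, ω'))) cascadeMeasure ∧
    ∫ ω', cascadeProduct h ν u ξ t (resample n (ω, ω')) ∂cascadeMeasure =
      truncatedProduct h ν u (cascadeSolution h ν u) n ξ t ω := by
  induction n generalizing ξ t with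
  | zero =>
    refine Filter.Eventually.of_forall fun ω => ?_
    simp only [resample_zero]
    refine ⟨hex ξ hξ t ht, ?_⟩
    rw [truncatedProduct, cascadeSolution, inv_smul_smul₀ (h.pos ξ hξ).ne']
  | succ n ih =>
    have hXm := measurable_cascadeProduct h ν hu
    have hYm : Measurable fun z : (Mode × ℝ × CascadeSpace) × CascadeSpace =>
        cascadeProduct h ν u z.1.1 z.1.2.1 (resample n (z.1.2.2, z.2)) := by
      have : Measurable fun z : (Mode × ℝ × CascadeSpace) × CascadeSpace =>
          resample n (z.1.2.2, z.2) :=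
        (measurable_resample n).comp (measurable_fst.snd.snd.prodMk measurable_snd)
      exact hXm.comp (measurable_fst.fst.prodMk (measurable_fst.snd.fst.prodMk this))
    have hset : MeasurableSet {q : Mode × ℝ × CascadeSpace | q.2.1 ∈ Icc 0 T →
        Integrable (fun ω' => cascadeProduct h ν u q.1 q.2.1 (resample n (q.2.2, ω')))
          cascadeMeasure ∧
        ∫ ω', cascadeProduct h ν u q.1 q.2.1 (resample n (q.2.2, ω')) ∂cascadeMeasure =
          truncatedProduct h ν u (cascadeSolution h ν u) n q.1 q.2.1 q.2.2} := by
      have m1 : MeasurableSet {q : Mode × ℝ × CascadeSpace | q.2.1 ∈ Icc 0 T} :=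
        measurable_snd.fst measurableSet_Icc
      have m2 : MeasurableSet {q : Mode × ℝ × CascadeSpace | Integrable (fun ω' =>
          cascadeProduct h ν u q.1 q.2.1 (resample n (q.2.2, ω'))) cascadeMeasure} :=
        measurableSet_integrable (f := fun (q : Mode × ℝ × CascadeSpace) ω' =>
          cascadeProduct h ν u q.1 q.2.1 (resample n (q.2.2, ω'))) hYm.stronglyMeasurable
      have m3 : Measurable fun q : Mode × ℝ × CascadeSpace =>
          ∫ ω', cascadeProduct h ν u q.1 q.2.1 (resample n (q.2.2, ω')) ∂cascadeMeasure :=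
        (hYm.stronglyMeasurable.integral_prod_right' (ν := cascadeMeasure)).measurable
      have m4 := measurable_truncatedProduct h ν hu (measurable_cascadeSolution h ν hu) n
      exact (m1.imp (m2.inter (measurableSet_eq_fun m3 m4)))
    have hchild := ae_child h hν (p := fun η r ω => r ∈ Icc 0 T →
        Integrable (fun ω' => cascadeProduct h ν u η r (resample n (ω, ω'))) cascadeMeasure ∧
        ∫ ω', cascadeProduct h ν u η r (resample n (ω, ω')) ∂cascadeMeasure =
          truncatedProduct h ν u (cascadeSolution h ν u) n η r ω) hset
      (fun η hη r => by
        by_cases hr : r ∈ Icc 0 T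
        · filter_upwards [ih hη hr] with ω hω _ using hω
        · exact Filter.Eventually.of_forall fun ω h' => absurd h' hr) hξ t
    have hrec : ∀ᵐ p ∂cascadeMeasure.prod cascadeMeasure, _ :=
      ae_of_ae_map (f := resample (n + 1)) (measurable_resample (n + 1)).aemeasurable
        (by rw [map_resample]; exact ae_cascadeProduct_eq_ite hν h_ne u hξ ht.1)
    filter_upwards [hchild, Measure.ae_ae_of_ae_prod hrec, ae_isNondegenerate h hξ] with
      ω hch hrecω hnd
    have hhold : ∀ ω', holdTime ν ξ (resample (n + 1) (ω, ω')) = holdTime ν ξ ω := fun ω' => by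
      rw [holdTime, resample_succ_nil, holdTime]
    have hcm : ∀ ω' b, childMode h ξ (resample (n + 1) (ω, ω')) b = childMode h ξ ω b :=
      fun ω' b => by rw [childMode, resample_succ_nil, childMode]
    simp only [hhold, hcm, subtree_resample] at hrecω
    rw [integrable_congr hrecω, integral_congr_ae hrecω]
    rcases lt_or_ge t (holdTime ν ξ ω) with hlt | hle
    · simp [truncatedProduct_of_lt hlt, hlt]
    · have hr : t - holdTime ν ξ ω ∈ Icc 0 T :=
        ⟨sub_nonneg.2 hle, by linarith [ht.2, hnd.holdTime_pos hν]⟩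
      obtain ⟨i0, e0⟩ := hch false hr
      obtain ⟨i1, e1⟩ := hch true hr
      rw [truncatedProduct_of_le hle, ← e0, ← e1]
      simp only [hle.not_gt, if_false]
      have hpres : MeasurePreserving (fun ω' => (subtree ω' false, subtree ω' true))
          cascadeMeasure (cascadeMeasure.prod cascadeMeasure) :=
        ⟨(measurable_subtree false).prodMk (measurable_subtree true), map_subtrees⟩
      have hprod := integrable_prod_odot ξ i0 i1
      refine ⟨(hpres.integrable_comp_of_integrable hprod).smul (branchFactor h ν ξ), ?_⟩
      rw [integral_smul]
      congr 1
      rw [← integral_prod_odot ξ i0 i1, ← map_subtrees,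
        integral_map hpres.measurable.aemeasurable (by
          rw [map_subtrees]; exact hprod.aestronglyMeasurable)]

/-- Integrating out one variable preserves uniform integrability: it does not increase the `L¹` norm on
cylinders over the remaining variable. -/
theorem uniformIntegrable_integral_prod {ι α β E : Type*} [MeasurableSpace α]
    [MeasurableSpace β] [NormedAddCommGroup E] [NormedSpace ℝ E] {μ : Measure α} {ν : Measure β}
    [SFinite μ] [SFinite ν] {f : ι → α × β → E} (hf : UniformIntegrable f 1 (μ.prod ν))
    [IsProbabilityMeasure ν] :
    UniformIntegrable (fun i a => ∫ b, f i (a, b) ∂ν) 1 μ := by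
  have hle : ∀ i (s : Set α), MeasurableSet s →
      eLpNorm (s.indicator fun a => ∫ b, f i (a, b) ∂ν) 1 μ ≤
        eLpNorm ((s ×ˢ univ).indicator (f i)) 1 (μ.prod ν) := by
    intro i s hs
    rw [eLpNorm_one_eq_lintegral_enorm, eLpNorm_one_eq_lintegral_enorm,
      lintegral_prod _ ((hf.1 i).indicator (hs.prod .univ)).enorm]
    refine lintegral_mono fun a => ?_
    by_cases ha : a ∈ s
    · simpa [ha, indicator] using enorm_integral_le_lintegral_enorm _
    · simp [ha]
  refine ⟨fun i => (hf.1 i).integral_prod_right', fun ε hε => ?_, ?_⟩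
  · obtain ⟨δ, hδ, H⟩ := hf.2.1 hε
    refine ⟨δ, hδ, fun i s hs hμ => (hle i s hs).trans (H i _ (hs.prod .univ) ?_)⟩
    rwa [Measure.prod_prod, measure_univ, mul_one]
  · obtain ⟨C, hC⟩ := hf.2.2
    refine ⟨C, fun i => ?_⟩
    simpa using (hle i univ .univ).trans (by simpa using hC i)

theorem hasCascadeExpectations_cascadeSolution (hν : 0 < ν) (h_ne : NonExplosive h)
    (hu : Measurable u) (hex : CascadeExpectationExists h ν T u) :
    HasCascadeExpectations h ν T (cascadeSolution h ν u) := by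
  intro ξ hξ t ht
  have hX : Measurable (cascadeProduct h ν u ξ t) :=
    (measurable_cascadeProduct h ν hu).comp
      (measurable_const.prodMk (measurable_const.prodMk measurable_id))
  -- resampling does not change the law, so all these variables are distributed like `X`
  have hlaw : ∀ n, IdentDistrib (fun p => cascadeProduct h ν u ξ t (resample n p))
      (cascadeProduct h ν u ξ t) (cascadeMeasure.prod cascadeMeasure) cascadeMeasure := fun n =>
    ⟨(hX.comp (measurable_resample n)).aemeasurable, hX.aemeasurable, by
      conv_rhs => rw [← map_resample n, Measure.map_map hX (measurable_resample n)]
      rfl⟩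
  have hUI : UniformIntegrable (fun n p => cascadeProduct h ν u ξ t (resample n p)) 1
      (cascadeMeasure.prod cascadeMeasure) :=
    MemLp.uniformIntegrable_of_identDistrib (j := 0) le_rfl ENNReal.one_ne_top
      ((hlaw 0).symm.memLp_snd (memLp_one_iff_integrable.2 (hex ξ hξ t ht)))
      fun n => (hlaw n).trans (hlaw 0).symm
  refine (uniformIntegrable_integral_prod hUI).ae_eq fun n => ?_
  filter_upwards [ae_integral_cascadeProduct_resample hν h_ne hu hex n hξ ht,
    ae_isNondegenerate h hξ] with ω h1 h2
  rw [h1.2]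
  exact truncatedProduct_congr hν (fun η hη => (cascadeSolution_zero hν h_ne u hη).symm)
    (fun _ _ _ _ => rfl) h2 ht n

end solution

/-! ### Uniqueness -/

section uniqueness

variable {h : MajorizingKernel} {ν T : ℝ} {u : Mode → CVec} {v : Mode → ℝ → CVec}

theorem IsMildSolution.apply_zero (hv : IsMildSolution ν T u v) (hT : 0 ≤ T) {ξ : Mode}
    (hξ : ξ ≠ 0) : v ξ 0 = u ξ := by
  have := hv.equation ξ hξ 0 ⟨le_rfl, hT⟩
  simpa using this

/-- A function on `[0, T]` extended to all times by its values at the end points: it is measurable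
on the whole space and agrees with the given one at the times in `[0, T]`. -/
noncomputable def clampTime (T : ℝ) (v : Mode → ℝ → CVec) (ξ : Mode) (t : ℝ) : CVec :=
  v ξ (max 0 (min T t))

theorem clampTime_of_mem {t : ℝ} (ht : t ∈ Icc 0 T) (ξ : Mode) : clampTime T v ξ t = v ξ t := by
  rw [clampTime, min_eq_right ht.2, max_eq_right ht.1]

theorem measurable_clampTime (hT : 0 ≤ T)
    (hv : Measurable fun p : Mode × Icc (0 : ℝ) T => v p.1 (p.2 : ℝ)) :
    Measurable fun p : Mode × ℝ => clampTime T v p.1 p.2 := by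
  have hm : Measurable fun p : Mode × ℝ =>
      (p.1, (⟨max 0 (min T p.2), le_max_left _ _, max_le hT (min_le_left _ _)⟩ : Icc (0 : ℝ) T)) :=
    measurable_fst.prodMk (Measurable.subtype_mk (by fun_prop))
  exact hv.comp hm

theorem measurable_truncatedProduct_clampTime (h : MajorizingKernel) (ν : ℝ) (hT : 0 ≤ T)
    (hv : Measurable fun p : Mode × Icc (0 : ℝ) T => v p.1 (p.2 : ℝ)) (n : ℕ) :
    Measurable fun p : Mode × ℝ × CascadeSpace =>
      truncatedProduct h ν (fun η => clampTime T v η 0) (clampTime T v) n p.1 p.2.1 p.2.2 := by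
  have hm := measurable_clampTime hT hv
  exact measurable_truncatedProduct h ν (hm.comp (measurable_id.prodMk measurable_const)) hm n

theorem ae_truncatedProduct_clampTime (hν : 0 < ν) (hT : 0 ≤ T) {ξ : Mode} (hξ : ξ ≠ 0) {t : ℝ}
    (ht : t ∈ Icc 0 T) (n : ℕ) :
    truncatedProduct h ν (fun η => clampTime T v η 0) (clampTime T v) n ξ t
      =ᵐ[cascadeMeasure] truncatedProduct h ν (fun η => v η 0) v n ξ t := by
  filter_upwards [ae_isNondegenerate h hξ] with ω hω
  exact truncatedProduct_congr hν (fun η _ => clampTime_of_mem ⟨le_rfl, hT⟩ η)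
    (fun η _ r hr => clampTime_of_mem hr η) hω ht n

/-- The cut-off products of a mild solution all have the same expectation: the mild formulation
allows one to let the particles of one more generation evolve. -/
theorem integral_truncatedProduct (hν : 0 < ν) (hT : 0 ≤ T) (hv : IsMildSolution ν T u v)
    (hint : ∀ n, ∀ ξ : Mode, ξ ≠ 0 → ∀ t ∈ Icc 0 T,
      Integrable (truncatedProduct h ν (fun η => v η 0) v n ξ t) cascadeMeasure)
    (n : ℕ) {ξ : Mode} (hξ : ξ ≠ 0) {t : ℝ} (ht : t ∈ Icc 0 T) :
    ∫ ω, truncatedProduct h ν (fun η => v η 0) v n ξ t ω ∂cascadeMeasure = (h ξ)⁻¹ • v ξ t := by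
  induction n generalizing ξ t with
  | zero => simp [truncatedProduct]
  | succ n ih =>
    have hint' : ∀ n, ∀ ξ : Mode, ξ ≠ 0 → ∀ t ∈ Icc 0 T, Integrable
        (truncatedProduct h ν (fun η => clampTime T v η 0) (clampTime T v) n ξ t)
        cascadeMeasure := fun n ξ hξ t ht =>
      (hint n ξ hξ t ht).congr (ae_truncatedProduct_clampTime hν hT hξ ht n).symm
    have key := (mild_of_step h hν (measurable_truncatedProduct_clampTime h ν hT hv.measurable n)
      (hint' n) hξ ht (clampTime T v ξ 0) (hint' (n + 1) ξ hξ t ht)).2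
    change h ξ • ∫ ω, truncatedProduct h ν (fun η => clampTime T v η 0) (clampTime T v) (n + 1) ξ t ω
      ∂cascadeMeasure = _ at key
    have hw : ∀ η, η ≠ 0 → ∀ r ∈ Icc 0 T, h η • ∫ ω, truncatedProduct h ν
        (fun η => clampTime T v η 0) (clampTime T v) n η r ω ∂cascadeMeasure = v η r := by
      intro η hη r hr
      rw [integral_congr_ae (ae_truncatedProduct_clampTime hν hT hη hr n), ih hη hr,
        smul_inv_smul₀ (h.pos η hη).ne']
    have hmild : ∫ s in (0 : ℝ)..t, ∫ η : Mode, mildIntegrand ν (fun η r => h η •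
        ∫ ω, truncatedProduct h ν (fun η => clampTime T v η 0) (clampTime T v) n η r ω
          ∂cascadeMeasure) ξ t s η =
        ∫ s in (0 : ℝ)..t, ∫ η : Mode, mildIntegrand ν v ξ t s η := by
      refine intervalIntegral.integral_congr fun s hs => integral_congr_ae ?_
      rw [uIcc_of_le ht.1] at hs
      have hr : t - s ∈ Icc 0 T := ⟨by linarith [hs.2], by linarith [hs.1, ht.2]⟩
      filter_upwards [ae_ne_volume 0, ae_ne_volume ξ] with η h1 h2
      simp only [mildIntegrand]
      rw [hw η h1 _ hr, hw _ (sub_ne_zero.2 h2.symm) _ hr]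
    rw [hmild, clampTime_of_mem ⟨le_rfl, hT⟩, hv.apply_zero hT hξ, ← hv.equation ξ hξ t ht] at key
    rw [← integral_congr_ae (ae_truncatedProduct_clampTime hν hT hξ ht (n + 1)), ← key,
      inv_smul_smul₀ (h.pos ξ hξ).ne']

theorem ae_tendsto_truncatedProduct (hν : 0 < ν) (hT : 0 ≤ T) (h_ne : NonExplosive h)
    (hv : IsMildSolution ν T u v) {ξ : Mode} (hξ : ξ ≠ 0) {t : ℝ} (ht : t ∈ Icc 0 T) :
    ∀ᵐ ω ∂cascadeMeasure, Filter.Tendsto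
      (fun n => truncatedProduct h ν (fun η => v η 0) v n ξ t ω) Filter.atTop
      (nhds (cascadeProduct h ν u ξ t ω)) := by
  filter_upwards [ae_finite_genealogy hν h_ne hξ t, ae_isNondegenerate h hξ] with ω h1 h2
  refine tendsto_const_nhds.congr' ?_
  filter_upwards [Filter.eventually_ge_atTop (genealogy h ν ξ t ω).ncard] with n hn
  rw [truncatedProduct_congr hν (fun η hη => hv.apply_zero hT hη) (fun _ _ _ _ => rfl) h2 ht n,
    truncatedProduct_eq_cascadeProduct hν h2 h1 ht.1 u v hn]

/-- Uniqueness reduces to passing to the limit in the expectations of the cut-off products, which do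
not depend on the generation of the cut-off. -/
theorem eq_cascadeSolution_of_tendsto (hν : 0 < ν) (hT : 0 ≤ T) (hv : IsMildSolution ν T u v)
    (hint : ∀ n, ∀ ξ : Mode, ξ ≠ 0 → ∀ t ∈ Icc 0 T,
      Integrable (truncatedProduct h ν (fun η => v η 0) v n ξ t) cascadeMeasure)
    {ξ : Mode} (hξ : ξ ≠ 0) {t : ℝ} (ht : t ∈ Icc 0 T)
    (hlim : Filter.Tendsto
      (fun n => ∫ ω, truncatedProduct h ν (fun η => v η 0) v n ξ t ω ∂cascadeMeasure) Filter.atTop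
      (nhds (∫ ω, cascadeProduct h ν u ξ t ω ∂cascadeMeasure))) :
    v ξ t = cascadeSolution h ν u ξ t := by
  simp only [integral_truncatedProduct hν hT hv hint _ hξ ht] at hlim
  rw [cascadeSolution, ← tendsto_nhds_unique tendsto_const_nhds hlim,
    smul_inv_smul₀ (h.pos ξ hξ).ne']

theorem unique_of_hasCascadeExpectations (hν : 0 < ν) (hT : 0 ≤ T) (h_ne : NonExplosive h)
    (hv : IsMildSolution ν T u v) (hex : HasCascadeExpectations h ν T v) :
    CascadeExpectationExists h ν T u ∧
      ∀ ξ : Mode, ξ ≠ 0 → ∀ t ∈ Icc 0 T, v ξ t = cascadeSolution h ν u ξ t := by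
  have hE : CascadeExpectationExists h ν T u := fun ξ hξ t ht =>
    (hex ξ hξ t ht).integrable_of_ae_tendsto (ae_tendsto_truncatedProduct hν hT h_ne hv hξ ht)
  have hint : ∀ n, ∀ ξ : Mode, ξ ≠ 0 → ∀ t ∈ Icc 0 T,
      Integrable (truncatedProduct h ν (fun η => v η 0) v n ξ t) cascadeMeasure :=
    fun n ξ hξ t ht => memLp_one_iff_integrable.1 ((hex ξ hξ t ht).memLp n)
  refine ⟨hE, fun ξ hξ t ht => eq_cascadeSolution_of_tendsto hν hT hv hint hξ ht ?_⟩
  refine tendsto_integral_of_L1' _ (hE ξ hξ t ht).1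
    (Filter.Eventually.of_forall fun n => hint n ξ hξ t ht) ?_
  exact tendsto_Lp_finite_of_tendsto_ae le_rfl ENNReal.one_ne_top (hex ξ hξ t ht).1
    (memLp_one_iff_integrable.2 (hE ξ hξ t ht)) (hex ξ hξ t ht).2.1
    (ae_tendsto_truncatedProduct hν hT h_ne hv hξ ht)

end uniqueness

/-! ### Solutions majorized by the kernel -/

section majorant

variable {h : MajorizingKernel} {ν T C : ℝ} {ξ : Mode} {ω : CascadeSpace} {t : ℝ}

theorem finite_branchPoints (hfin : (genealogy h ν ξ t ω).Finite) :
    (branchPoints h ν ξ t ω).Finite :=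
  hfin.preimage fun _ _ _ _ e => List.append_cancel_right e

theorem one_le_majorantProduct : 1 ≤ majorantProduct h ν C ξ t ω :=
  finprod_mem_induction (fun x : ℝ => 1 ≤ x) le_rfl (fun _ _ => one_le_mul_of_one_le_of_one_le)
    fun _ _ => le_max_left _ _

theorem cons_mem_branchPoints (b : Bool) (s : List Bool) :
    b :: s ∈ branchPoints h ν ξ t ω ↔
      s ∈ branchPoints h ν (childMode h ξ ω b) (t - holdTime ν ξ ω) (subtree ω b) :=
  cons_mem_genealogy b (s ++ [false])

theorem nil_mem_branchPoints : [] ∈ branchPoints h ν ξ t ω ↔ holdTime ν ξ ω ≤ t :=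
  (cons_mem_genealogy false []).trans (nil_mem_genealogy.trans sub_nonneg)

theorem majorantProduct_of_le (hfin : (genealogy h ν ξ t ω).Finite) (hle : holdTime ν ξ ω ≤ t) :
    majorantProduct h ν C ξ t ω = max 1 (C * branchFactor h ν ξ) *
      (majorantProduct h ν C (childMode h ξ ω false) (t - holdTime ν ξ ω) (subtree ω false) *
        majorantProduct h ν C (childMode h ξ ω true) (t - holdTime ν ξ ω) (subtree ω true)) := by
  let B : Bool → Set (List Bool) := fun b =>
    branchPoints h ν (childMode h ξ ω b) (t - holdTime ν ξ ω) (subtree ω b)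
  have hB : ∀ b, (B b).Finite := fun b => finite_branchPoints (finite_genealogy_child hfin b)
  have hset : branchPoints h ν ξ t ω =
      insert [] ((fun s => false :: s) '' B false ∪ (fun s => true :: s) '' B true) := by
    ext s
    rcases s with _ | ⟨_ | _, s⟩
    · simpa using nil_mem_branchPoints.2 hle
    · simp [cons_mem_branchPoints, B]
    · simp [cons_mem_branchPoints, B]
  have hdisj : Disjoint ((fun s => false :: s) '' B false) ((fun s => true :: s) '' B true) := by
    rw [Set.disjoint_left]
    rintro _ ⟨s, _, rfl⟩ ⟨s', _, hs'⟩
    simp at hs'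
  have hinj : ∀ b : Bool, InjOn (fun s : List Bool => b :: s) (B b) := fun b x _ y _ e => by
    simpa using e
  rw [majorantProduct, hset, finprod_mem_insert _ (by simp)
    (((hB false).image _).union ((hB true).image _)), finprod_mem_union hdisj
    ((hB false).image _) ((hB true).image _), finprod_mem_image (hinj false),
    finprod_mem_image (hinj true)]
  rfl

theorem branchFactor_nonneg (hν : 0 < ν) (hξ : ξ ≠ 0) : 0 ≤ branchFactor h ν ξ := by
  have := h.pos ξ hξ
  unfold branchFactor
  positivity

theorem norm_inv_smul_le (hC : 0 ≤ C) (hξ : ξ ≠ 0) {a : CVec} (ha : ‖a‖ ≤ C * h ξ) :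
    ‖(h ξ)⁻¹ • a‖ ≤ C * majorantProduct h ν C ξ t ω := by
  have hh := h.pos ξ hξ
  rw [norm_smul, norm_inv, Real.norm_of_nonneg hh.le, inv_mul_le_iff₀ hh, mul_comm]
  exact ha.trans (mul_le_mul_of_nonneg_right
    (le_mul_of_one_le_right hC one_le_majorantProduct) hh.le)

/-- A finite binary tree has one more leaf than branch points, so the bounds `C` at its leaves leave
one factor `C` over when they are distributed over the branch points. -/
theorem norm_truncatedProduct_le {v : Mode → ℝ → CVec} (hν : 0 < ν) (hC : 0 ≤ C)
    (hv : ∀ η : Mode, η ≠ 0 → ∀ r ∈ Icc 0 T, ‖v η r‖ ≤ C * h η) (n : ℕ)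
    (H : IsNondegenerate h ξ ω) (hfin : (genealogy h ν ξ t ω).Finite) (ht : t ∈ Icc 0 T) :
    ‖truncatedProduct h ν (fun η => v η 0) v n ξ t ω‖ ≤ C * majorantProduct h ν C ξ t ω := by
  induction n generalizing ξ t ω with
  | zero => exact norm_inv_smul_le hC H.ne_zero (hv ξ H.ne_zero t ht)
  | succ n ih =>
    rcases lt_or_ge t (holdTime ν ξ ω) with hlt | hle
    · rw [truncatedProduct_of_lt hlt]
      exact norm_inv_smul_le hC H.ne_zero (hv ξ H.ne_zero 0 ⟨le_rfl, ht.1.trans ht.2⟩)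
    · have hr : t - holdTime ν ξ ω ∈ Icc 0 T :=
        ⟨sub_nonneg.2 hle, by linarith [ht.2, H.holdTime_pos hν]⟩
      have hb := branchFactor_nonneg (h := h) hν H.ne_zero
      have key : ∀ b, ‖truncatedProduct h ν (fun η => v η 0) v n (childMode h ξ ω b)
          (t - holdTime ν ξ ω) (subtree ω b)‖ ≤ C * majorantProduct h ν C (childMode h ξ ω b)
          (t - holdTime ν ξ ω) (subtree ω b) := fun b =>
        ih (H.child b) (finite_genealogy_child hfin b) hr
      rw [truncatedProduct_of_le hle, norm_smul, Real.norm_of_nonneg hb,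
        majorantProduct_of_le hfin hle]
      set M : Bool → ℝ := fun b => majorantProduct h ν C (childMode h ξ ω b)
          (t - holdTime ν ξ ω) (subtree ω b)
      have hM : ∀ b, 0 ≤ M b := fun b => zero_le_one.trans one_le_majorantProduct
      calc _ ≤ branchFactor h ν ξ * ((C * M false) * (C * M true)) := by
            refine mul_le_mul_of_nonneg_left ((norm_odot_le _ _ _).trans ?_) hb
            exact mul_le_mul (key false) (key true) (norm_nonneg _) (mul_nonneg hC (hM _))
        _ = C * ((C * branchFactor h ν ξ) * (M false * M true)) := by ring
        _ ≤ _ := by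
            refine mul_le_mul_of_nonneg_left (mul_le_mul_of_nonneg_right (le_max_right _ _) ?_) hC
            exact mul_nonneg (hM _) (hM _)

theorem unique_of_norm_le {u : Mode → CVec} {v : Mode → ℝ → CVec} (hν : 0 < ν) (hT : 0 ≤ T)
    (h_ne : NonExplosive h) (hu : Measurable u)
    (hmaj : ∀ ξ : Mode, ξ ≠ 0 → ∀ t ∈ Icc 0 T,
      ∫⁻ ω, ENNReal.ofReal (majorantProduct h ν C ξ t ω) ∂cascadeMeasure < ⊤)
    (hv : IsMildSolution ν T u v)
    (hle : ∀ ξ : Mode, ξ ≠ 0 → ∀ t ∈ Icc 0 T, ‖v ξ t‖ ≤ C * h ξ) :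
    CascadeExpectationExists h ν T u ∧
      ∀ ξ : Mode, ξ ≠ 0 → ∀ t ∈ Icc 0 T, v ξ t = cascadeSolution h ν u ξ t := by
  have hC : 0 ≤ C := by
    obtain ⟨ξ, hξ⟩ := exists_ne (0 : Mode)
    have := (norm_nonneg _).trans (hle ξ hξ 0 ⟨le_rfl, hT⟩)
    exact nonneg_of_mul_nonneg_left this (h.pos ξ hξ)
  -- the products cut off at all generations have the integrable majorant `S`, which unlike the
  -- majorant product is visibly measurable
  let X : ℕ → Mode → ℝ → CascadeSpace → CVec :=
    truncatedProduct h ν (fun η => clampTime T v η 0) (clampTime T v)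
  let S : Mode → ℝ → CascadeSpace → ENNReal := fun ξ t ω => ⨆ n, ‖X n ξ t ω‖ₑ
  have hXm : ∀ n ξ t, Measurable (X n ξ t) := fun n ξ t =>
    (measurable_truncatedProduct_clampTime h ν hT hv.measurable n).comp
      (measurable_const.prodMk (measurable_const.prodMk measurable_id))
  have hSm : ∀ ξ t, Measurable (S ξ t) := fun ξ t => Measurable.iSup fun n => (hXm n ξ t).enorm
  have hX : ∀ ξ : Mode, ξ ≠ 0 → ∀ t ∈ Icc 0 T, ∀ᵐ ω ∂cascadeMeasure, ∀ n,
      X n ξ t ω = truncatedProduct h ν (fun η => v η 0) v n ξ t ω := fun ξ hξ t ht =>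
    ae_all_iff.2 fun n => ae_truncatedProduct_clampTime hν hT hξ ht n
  have hSint : ∀ ξ : Mode, ξ ≠ 0 → ∀ t ∈ Icc 0 T, ∫⁻ ω, S ξ t ω ∂cascadeMeasure ≠ ⊤ := by
    intro ξ hξ t ht
    refine ne_top_of_le_ne_top
      (ENNReal.mul_ne_top (ENNReal.ofReal_ne_top (r := C)) (hmaj ξ hξ t ht).ne) ?_
    rw [← lintegral_const_mul' _ _ ENNReal.ofReal_ne_top]
    refine lintegral_mono_ae ?_
    filter_upwards [hX ξ hξ t ht, ae_finite_genealogy hν h_ne hξ t, ae_isNondegenerate h hξ] with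
      ω h1 h2 h3
    refine iSup_le fun n => ?_
    rw [h1, ← ENNReal.ofReal_mul hC, ← ofReal_norm]
    exact ENNReal.ofReal_le_ofReal (norm_truncatedProduct_le hν hC hle n h3 h2 ht)
  have hbound : ∀ ξ : Mode, ξ ≠ 0 → ∀ t ∈ Icc 0 T, ∀ᵐ ω ∂cascadeMeasure, ∀ n,
      ‖truncatedProduct h ν (fun η => v η 0) v n ξ t ω‖ ≤ (S ξ t ω).toReal := by
    intro ξ hξ t ht
    filter_upwards [hX ξ hξ t ht, ae_lt_top (hSm ξ t) (hSint ξ hξ t ht)] with ω h1 h2 n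
    rw [← h1, ← toReal_enorm]
    exact ENNReal.toReal_mono h2.ne (le_iSup (fun n => ‖X n ξ t ω‖ₑ) n)
  have hSi : ∀ ξ : Mode, ξ ≠ 0 → ∀ t ∈ Icc 0 T,
      Integrable (fun ω => (S ξ t ω).toReal) cascadeMeasure := fun ξ hξ t ht =>
    integrable_toReal_of_lintegral_ne_top (hSm ξ t).aemeasurable (hSint ξ hξ t ht)
  have hm : ∀ n, ∀ ξ : Mode, ξ ≠ 0 → ∀ t ∈ Icc 0 T, AEStronglyMeasurable
      (truncatedProduct h ν (fun η => v η 0) v n ξ t) cascadeMeasure := fun n ξ hξ t ht =>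
    (hXm n ξ t).aestronglyMeasurable.congr (ae_truncatedProduct_clampTime hν hT hξ ht n)
  have hint : ∀ n, ∀ ξ : Mode, ξ ≠ 0 → ∀ t ∈ Icc 0 T,
      Integrable (truncatedProduct h ν (fun η => v η 0) v n ξ t) cascadeMeasure :=
    fun n ξ hξ t ht => (hSi ξ hξ t ht).mono' (hm n ξ hξ t ht) <| by
      filter_upwards [hbound ξ hξ t ht] with ω hω using hω n
  have hlim : ∀ ξ : Mode, ξ ≠ 0 → ∀ t ∈ Icc 0 T, _ := fun ξ hξ t ht =>
    ae_tendsto_truncatedProduct hν hT h_ne hv hξ ht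
  refine ⟨fun ξ hξ t ht => ?_, fun ξ hξ t ht =>
    eq_cascadeSolution_of_tendsto hν hT hv hint hξ ht ?_⟩
  · have hcm : Measurable (cascadeProduct h ν u ξ t) :=
      (measurable_cascadeProduct h ν hu).comp
        (measurable_const.prodMk (measurable_const.prodMk measurable_id))
    refine (hSi ξ hξ t ht).mono' hcm.aestronglyMeasurable ?_
    filter_upwards [hbound ξ hξ t ht, hlim ξ hξ t ht] with ω h1 h2
    exact le_of_tendsto h2.norm (Filter.Eventually.of_forall h1)
  · exact tendsto_integral_of_dominated_convergence _ (fun n => hm n ξ hξ t ht) (hSi ξ hξ t ht)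
      (fun n => by filter_upwards [hbound ξ hξ t ht] with ω hω using hω n) (hlim ξ hξ t ht)

end majorant

/-! ### Scaling of the explosion time -/

section scaling

variable {h : MajorizingKernel} {ξ : Mode} {ω : CascadeSpace}

/-- The least time, in units where `ν = 1`, at which all the particles in the generations `≤ n` along
some line of descent have branched. Unlike `explosionTimeAt` it counts the root. -/
noncomputable def branchTimeAt (h : MajorizingKernel) : ℕ → Mode → CascadeSpace → ENNReal
  | 0, ξ, ω => ENNReal.ofReal ((‖ξ‖ ^ 2)⁻¹ * (ω []).1)
  | n + 1, ξ, ω => ENNReal.ofReal ((‖ξ‖ ^ 2)⁻¹ * (ω []).1) +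
      min (branchTimeAt h n (childMode h ξ ω false) (subtree ω false))
        (branchTimeAt h n (childMode h ξ ω true) (subtree ω true))

theorem iInf_length_succ (n : ℕ) (f : List Bool → ENNReal) :
    ⨅ (s : List Bool) (_ : s.length = n + 1), f s =
      min (⨅ (s : List Bool) (_ : s.length = n), f (false :: s))
        (⨅ (s : List Bool) (_ : s.length = n), f (true :: s)) := by
  refine le_antisymm (le_min ?_ ?_) (le_iInf₂ ?_)
  · exact le_iInf₂ fun s hs => iInf₂_le (false :: s) (by simp [hs])
  · exact le_iInf₂ fun s hs => iInf₂_le (true :: s) (by simp [hs])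
  · rintro (_ | ⟨_ | _, s⟩) hs
    · simp at hs
    · exact (min_le_left _ _).trans (iInf₂_le s (by simpa using hs))
    · exact (min_le_right _ _).trans (iInf₂_le s (by simpa using hs))

theorem branchTimeAt_eq_iInf (n : ℕ) : branchTimeAt h n ξ ω =
    ⨅ (s : List Bool) (_ : s.length = n), ∑ j ∈ Finset.range (n + 1),
      ENNReal.ofReal ((‖nodeMode h ξ ω (s.take j)‖ ^ 2)⁻¹ * (ω (s.take j)).1) := by
  induction n generalizing ξ ω with
  | zero => simp [branchTimeAt, List.length_eq_zero_iff, nodeMode]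
  | succ n ih =>
    simp only [Finset.sum_range_succ' _ (n + 1), List.take_zero]
    rw [iInf_length_succ]
    simp only [List.take_succ_cons, nodeMode]
    rw [branchTimeAt, ih, ih]
    simp only [add_comm _ (ENNReal.ofReal ((‖ξ‖ ^ 2)⁻¹ * (ω []).1)), ← ENNReal.add_iInf, subtree,
      min_add_add_left]

theorem explosionTimeAt_zero : explosionTimeAt h 0 ξ ω = 0 := by
  simp [explosionTimeAt, List.length_eq_zero_iff]

theorem explosionTimeAt_succ (n : ℕ) : explosionTimeAt h (n + 1) ξ ω =
    min (branchTimeAt h n (childMode h ξ ω false) (subtree ω false))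
      (branchTimeAt h n (childMode h ξ ω true) (subtree ω true)) := by
  have e : ∀ f : ℕ → ENNReal, ∑ j ∈ Finset.Icc 1 (n + 1), f j =
      ∑ j ∈ Finset.range (n + 1), f (j + 1) := fun f =>
    Finset.sum_nbij' (· - 1) (· + 1) (fun j hj => by simp at hj ⊢; omega) (fun j hj => by simpa using hj)
      (fun j hj => by simp at hj ⊢; omega) (fun j _ => by simp)
      (fun j hj => by simp at hj; rw [Nat.sub_add_cancel hj.1])
  simp only [explosionTimeAt, e]
  rw [iInf_length_succ, branchTimeAt_eq_iInf, branchTimeAt_eq_iInf]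
  rfl

theorem explosionTimeAt_le_succ (n : ℕ) :
    explosionTimeAt h n ξ ω ≤ explosionTimeAt h (n + 1) ξ ω := by
  refine le_iInf₂ fun s hs => (iInf₂_le (s.take n) (by simp [hs])).trans ?_
  calc _ = ∑ j ∈ Finset.Icc 1 n, ENNReal.ofReal
          ((‖nodeMode h ξ ω (s.take j)‖ ^ 2)⁻¹ * (ω (s.take j)).1) := by
        refine Finset.sum_congr rfl fun j hj => ?_
        rw [List.take_take, min_eq_left (Finset.mem_Icc.1 hj).2]
    _ ≤ _ := Finset.sum_le_sum_of_subset (Finset.Icc_subset_Icc_right n.le_succ)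

theorem measurable_branchTimeAt (h : MajorizingKernel) (n : ℕ) :
    Measurable fun p : Mode × CascadeSpace => branchTimeAt h n p.1 p.2 := by
  have h0 : Measurable fun p : Mode × CascadeSpace =>
      ENNReal.ofReal ((‖p.1‖ ^ 2)⁻¹ * (p.2 []).1) := by
    have : Measurable fun p : Mode × CascadeSpace => p.2 [] :=
      (measurable_pi_apply []).comp measurable_snd
    fun_prop
  induction n with
  | zero => exact h0
  | succ n ih =>
    exact h0.add ((ih.comp (measurable_child_subtree h false)).min
      (ih.comp (measurable_child_subtree h true)))

theorem measurable_explosionTimeAt (h : MajorizingKernel) (n : ℕ) (ξ : Mode) :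
    Measurable (explosionTimeAt h n ξ) := by
  cases n with
  | zero =>
    have : explosionTimeAt h 0 ξ = fun _ => 0 := funext fun ω => explosionTimeAt_zero
    rw [this]
    exact measurable_const
  | succ n =>
    have hb : ∀ b, Measurable fun ω => branchTimeAt h n (childMode h ξ ω b) (subtree ω b) :=
      fun b => ((measurable_branchTimeAt h n).comp (measurable_child_subtree h b)).comp
        (measurable_const.prodMk measurable_id)
    have : explosionTimeAt h (n + 1) ξ = _ := funext fun ω => explosionTimeAt_succ n
    rw [this]
    exact (hb false).min (hb true)

theorem lintegral_comp_smul {r : ℝ} (hr : 0 < r) {F : Mode → ENNReal} (hF : Measurable F) :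
    ∫⁻ η, F η = ENNReal.ofReal (r ^ 3) * ∫⁻ η, F (r • η) := by
  rw [← lintegral_map (μ := volume) (g := fun η : Mode => r • η) hF (by fun_prop),
    Measure.map_addHaar_smul volume hr.ne', lintegral_smul_measure, smul_eq_mul, ← mul_assoc,
    ← ENNReal.ofReal_mul (by positivity)]
  simp [abs_of_pos hr, hr.ne']

theorem branchDensity_rescale (h : MajorizingKernel) {r : ℝ} (hr : 0 < r) (ξ η : Mode) :
    ENNReal.ofReal (r ^ 3) * branchDensity (h.rescale r hr) (r • ξ) (r • η) =
      branchDensity h ξ η := by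
  have e1 : ∀ x : Mode, ENNReal.ofReal (h.rescale r hr (r • x)) =
      ENNReal.ofReal (r ^ 2)⁻¹ * ENNReal.ofReal (h x) := fun x => by
    rw [← ENNReal.ofReal_mul (by positivity)]
    simp [MajorizingKernel.rescale, smul_smul, hr.ne']
  have e2 : selfConv (h.rescale r hr) (r • ξ) = ENNReal.ofReal r⁻¹ * selfConv h ξ := by
    refine (selfConv_rescale h h.measurable hr (r • ξ)).trans ?_
    rw [smul_smul, inv_mul_cancel₀ hr.ne', one_smul]
  have e3 : ENNReal.ofReal (r ^ 3) * (ENNReal.ofReal (r ^ 2)⁻¹ * ENNReal.ofReal (r ^ 2)⁻¹) =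
      ENNReal.ofReal r⁻¹ := by
    rw [← ENNReal.ofReal_mul (by positivity), ← ENNReal.ofReal_mul (by positivity)]
    congr 1
    field_simp
  calc ENNReal.ofReal (r ^ 3) * branchDensity (h.rescale r hr) (r • ξ) (r • η)
      = (ENNReal.ofReal (r ^ 3) * (ENNReal.ofReal (r ^ 2)⁻¹ * ENNReal.ofReal (r ^ 2)⁻¹)) *
          (ENNReal.ofReal (h η) * ENNReal.ofReal (h (ξ - η))) /
          (ENNReal.ofReal r⁻¹ * selfConv h ξ) := by
        rw [branchDensity, ← smul_sub, e1, e1, e2, ← mul_div_assoc]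
        congr 1
        ring
    _ = branchDensity h ξ η := by
        rw [e3, ENNReal.mul_div_mul_left _ _ (by simpa using hr) ENNReal.ofReal_ne_top,
          branchDensity]

theorem branchLaw_rescale (h : MajorizingKernel) {r : ℝ} (hr : 0 < r) (ξ : Mode) :
    branchLaw (h.rescale r hr) (r • ξ) = (branchLaw h ξ).map fun η => r • η := by
  have hm : Measurable fun η : Mode => r • η := by fun_prop
  have hd := (measurable_branchDensity h).of_uncurry_left (x := ξ)
  have hd' := (measurable_branchDensity (h.rescale r hr)).of_uncurry_left (x := r • ξ)
  refine Measure.ext_of_lintegral _ fun F hF => ?_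
  have hFm : Measurable fun η : Mode => F (r • η) := hF.comp hm
  rw [lintegral_map hF hm, branchLaw, branchLaw, lintegral_withDensity_eq_lintegral_mul _ hd' hF,
    lintegral_withDensity_eq_lintegral_mul _ hd hFm, lintegral_comp_smul hr (hd'.mul hF),
    ← lintegral_const_mul' _ _ ENNReal.ofReal_ne_top]
  refine lintegral_congr fun η => ?_
  simp only [Pi.mul_apply]
  rw [← mul_assoc, branchDensity_rescale h hr]

/-- Equality in law is passed on from the two subtrees to the whole tree. -/
theorem map_add_min_rescale (h : MajorizingKernel) {r : ℝ} (hr : 0 < r)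
    {A' A : Mode → CascadeSpace → ENNReal}
    (hA' : Measurable fun p : Mode × CascadeSpace => A' p.1 p.2)
    (hA : Measurable fun p : Mode × CascadeSpace => A p.1 p.2)
    (hlaw : ∀ η, η ≠ 0 → cascadeMeasure.map (A' (r • η)) = cascadeMeasure.map (A η))
    {c : ℝ → ENNReal} (hc : Measurable c) {ξ : Mode} (hξ : ξ ≠ 0) :
    cascadeMeasure.map (fun ω => c (ω []).1 + min
      (A' (childMode (h.rescale r hr) (r • ξ) ω false) (subtree ω false))
      (A' (childMode (h.rescale r hr) (r • ξ) ω true) (subtree ω true))) =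
    cascadeMeasure.map (fun ω => c (ω []).1 + min
      (A (childMode h ξ ω false) (subtree ω false))
      (A (childMode h ξ ω true) (subtree ω true))) := by
  -- the expectation of a function of such a variable, computed through the first step
  have key : ∀ (k : MajorizingKernel) (B : Mode → CascadeSpace → ENNReal),
      (Measurable fun p : Mode × CascadeSpace => B p.1 p.2) → ∀ (ζ : Mode), ζ ≠ 0 →
      ∀ F : ENNReal → ENNReal, Measurable F →
      ∫⁻ x, F x ∂cascadeMeasure.map (fun ω => c (ω []).1 + min
        (B (childMode k ζ ω false) (subtree ω false))
        (B (childMode k ζ ω true) (subtree ω true))) =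
      ∫⁻ T, ∫⁻ η, ∫⁻ q, F (c T + min (B η q.1) (B (ζ - η) q.2))
        ∂cascadeMeasure.prod cascadeMeasure ∂branchLaw k ζ ∂expMeasure 1 := by
    intro k B hB ζ hζ F hF
    have hG : Measurable (sampler k ζ) := (measurable_sampler k).of_uncurry_left
    have hS : Measurable (fun ω : CascadeSpace => (((ω []).1, sampler k ζ (ω []).2),
        (subtree ω false, subtree ω true))) :=
      ((measurable_pi_apply []).fst.prodMk (hG.comp (measurable_pi_apply []).snd)).prodMk
        ((measurable_subtree false).prodMk (measurable_subtree true))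
    have hb : ∀ b, Measurable fun ω => B (childMode k ζ ω b) (subtree ω b) := fun b =>
      (hB.comp (measurable_child_subtree k b)).comp (measurable_const.prodMk measurable_id)
    have hc' : Measurable fun ω : CascadeSpace => c (ω []).1 :=
      hc.comp (measurable_pi_apply []).fst
    let g : (ℝ × Mode) × CascadeSpace × CascadeSpace → ENNReal := fun z =>
      F (c z.1.1 + min (B z.1.2 z.2.1) (B (ζ - z.1.2) z.2.2))
    have hg : Measurable g := by
      have m1 : Measurable fun z : (ℝ × Mode) × CascadeSpace × CascadeSpace => B z.1.2 z.2.1 := by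
        have : Measurable fun z : (ℝ × Mode) × CascadeSpace × CascadeSpace =>
          (z.1.2, z.2.1) := by fun_prop
        exact hB.comp this
      have m2 : Measurable fun z : (ℝ × Mode) × CascadeSpace × CascadeSpace =>
          B (ζ - z.1.2) z.2.2 := by
        have : Measurable fun z : (ℝ × Mode) × CascadeSpace × CascadeSpace =>
          (ζ - z.1.2, z.2.2) := by fun_prop
        exact hB.comp this
      exact hF.comp ((hc.comp measurable_fst.fst).add (m1.min m2))
    have hsum : Measurable fun ω : CascadeSpace => c (ω []).1 + min
        (B (childMode k ζ ω false) (subtree ω false))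
        (B (childMode k ζ ω true) (subtree ω true)) := hc'.add ((hb false).min (hb true))
    rw [lintegral_map hF hsum]
    have e : ∀ ω : CascadeSpace, F (c (ω []).1 + min
        (B (childMode k ζ ω false) (subtree ω false))
        (B (childMode k ζ ω true) (subtree ω true))) =
        g (((ω []).1, sampler k ζ (ω []).2), (subtree ω false, subtree ω true)) := fun ω => by
      simp [g, childMode]
    simp_rw [e]
    rw [← lintegral_map hg hS, map_firstStep k hζ, lintegral_prod _ hg.aemeasurable,
      lintegral_prod _ hg.lintegral_prod_right'.aemeasurable]
  have hprod : ∀ (B : Mode → CascadeSpace → ENNReal),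
      (Measurable fun p : Mode × CascadeSpace => B p.1 p.2) → ∀ F : ENNReal → ENNReal,
      Measurable F → ∀ T η ζ, ∫⁻ q, F (c T + min (B η q.1) (B ζ q.2))
        ∂cascadeMeasure.prod cascadeMeasure = ∫⁻ q, F (c T + min q.1 q.2)
        ∂(cascadeMeasure.map (B η)).prod (cascadeMeasure.map (B ζ)) := by
    intro B hB F hF T η ζ
    have hBm : ∀ η, Measurable (B η) := fun η => hB.comp (measurable_const.prodMk measurable_id)
    have hq : Measurable fun q : ENNReal × ENNReal => F (c T + min q.1 q.2) := by fun_prop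
    rw [Measure.map_prod_map _ _ (hBm _) (hBm _), lintegral_map hq ((hBm _).prodMap (hBm _))]
    rfl
  refine Measure.ext_of_lintegral _ fun F hF => ?_
  rw [key _ A' hA' _ (smul_ne_zero hr.ne' hξ) F hF, key _ A hA _ hξ F hF]
  refine lintegral_congr fun T => ?_
  have hm : Measurable fun z : Mode × CascadeSpace × CascadeSpace =>
      F (c T + min (A' z.1 z.2.1) (A' (r • ξ - z.1) z.2.2)) := by
    have m1 : Measurable fun z : Mode × CascadeSpace × CascadeSpace => A' z.1 z.2.1 :=
      hA'.comp (measurable_fst.prodMk measurable_snd.fst)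
    have m2 : Measurable fun z : Mode × CascadeSpace × CascadeSpace =>
        A' (r • ξ - z.1) z.2.2 :=
      hA'.comp ((measurable_const.sub measurable_fst).prodMk measurable_snd.snd)
    exact hF.comp (measurable_const.add (m1.min m2))
  rw [branchLaw_rescale, lintegral_map hm.lintegral_prod_right' (by fun_prop)]
  refine lintegral_congr_ae ?_
  filter_upwards [ae_branchLaw_ne h ξ] with η hη
  rw [← smul_sub, hprod A' hA' F hF, hprod A hA F hF, hlaw η hη.1, hlaw _ hη.2]

theorem map_branchTimeAt_rescale (h : MajorizingKernel) {r : ℝ} (hr : 0 < r) (n : ℕ) {ξ : Mode}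
    (hξ : ξ ≠ 0) :
    cascadeMeasure.map (fun ω =>
      ENNReal.ofReal (r ^ 2) * branchTimeAt (h.rescale r hr) n (r • ξ) ω) =
    cascadeMeasure.map (branchTimeAt h n ξ) := by
  have e : ∀ {ξ : Mode}, ξ ≠ 0 → ∀ x, ENNReal.ofReal (r ^ 2) *
      ENNReal.ofReal ((‖r • ξ‖ ^ 2)⁻¹ * x) = ENNReal.ofReal ((‖ξ‖ ^ 2)⁻¹ * x) := fun {ξ} hξ x => by
    rw [← ENNReal.ofReal_mul (by positivity), norm_smul, Real.norm_of_nonneg hr.le]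
    congr 1
    have := norm_ne_zero_iff.2 hξ
    field_simp
  induction n generalizing ξ with
  | zero => simp only [branchTimeAt, e hξ]
  | succ n ih =>
    simp only [branchTimeAt, mul_add, e hξ, mul_min]
    exact map_add_min_rescale h hr
      (A' := fun η ω => ENNReal.ofReal (r ^ 2) * branchTimeAt (h.rescale r hr) n η ω)
      ((measurable_branchTimeAt _ n).const_mul _) (measurable_branchTimeAt h n)
      (fun η hη => ih hη) (c := fun x => ENNReal.ofReal ((‖ξ‖ ^ 2)⁻¹ * x)) (by fun_prop) hξ

theorem map_explosionTimeAt_rescale (h : MajorizingKernel) {r : ℝ} (hr : 0 < r) (n : ℕ) {ξ : Mode}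
    (hξ : ξ ≠ 0) :
    cascadeMeasure.map (fun ω =>
      ENNReal.ofReal (r ^ 2) * explosionTimeAt (h.rescale r hr) n (r • ξ) ω) =
    cascadeMeasure.map (explosionTimeAt h n ξ) := by
  cases n with
  | zero =>
    have : explosionTimeAt h 0 ξ = fun _ => 0 := funext fun ω => explosionTimeAt_zero
    simp [explosionTimeAt_zero, this]
  | succ n =>
    have e : explosionTimeAt h (n + 1) ξ = _ := funext fun ω => explosionTimeAt_succ n
    simp only [e, explosionTimeAt_succ, mul_min]
    simpa using map_add_min_rescale h hr
      (A' := fun η ω => ENNReal.ofReal (r ^ 2) * branchTimeAt (h.rescale r hr) n η ω)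
      ((measurable_branchTimeAt _ n).const_mul _) (measurable_branchTimeAt h n)
      (fun η hη => map_branchTimeAt_rescale h hr n hη) (c := fun _ => 0) measurable_const hξ

/-- The law of the limit of a nondecreasing sequence is determined by the laws of its terms. -/
theorem map_iSup_apply_Iic {α : Type*} [MeasurableSpace α] {μ : Measure α} [IsFiniteMeasure μ]
    {f : ℕ → α → ENNReal} (hf : ∀ n, Measurable (f n)) (hmono : Monotone f) (x : ENNReal) :
    μ.map (fun a => ⨆ n, f n a) (Iic x) = ⨅ n, μ.map (f n) (Iic x) := by
  have hanti : Antitone fun n => f n ⁻¹' Iic x := fun i j hij a ha => (hmono hij a).trans ha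
  rw [Measure.map_apply (Measurable.iSup hf) measurableSet_Iic]
  simp only [fun n => Measure.map_apply (μ := μ) (hf n) (measurableSet_Iic (a := x))]
  rw [← hanti.measure_iInter (fun n => (hf n measurableSet_Iic).nullMeasurableSet)
    ⟨0, measure_ne_top _ _⟩]
  congr 1
  ext a
  simp

theorem map_explosionTime_rescale (h : MajorizingKernel) {r : ℝ} (hr : 0 < r) {ξ : Mode}
    (hξ : ξ ≠ 0) :
    cascadeMeasure.map (fun ω => ENNReal.ofReal (r ^ 2) * explosionTime (h.rescale r hr) (r • ξ) ω) =
      cascadeMeasure.map (explosionTime h ξ) := by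
  have e : explosionTime h ξ = fun ω => ⨆ n, explosionTimeAt h n ξ ω := rfl
  simp only [e, explosionTime, ENNReal.mul_iSup]
  refine Measure.ext_of_Iic _ _ fun x => ?_
  rw [map_iSup_apply_Iic (fun n => (measurable_explosionTimeAt _ n _).const_mul _)
      (monotone_nat_of_le_succ fun n ω => mul_le_mul_right (explosionTimeAt_le_succ n) _),
    map_iSup_apply_Iic (fun n => measurable_explosionTimeAt h n ξ)
      (monotone_nat_of_le_succ fun n ω => explosionTimeAt_le_succ n)]
  simp only [map_explosionTimeAt_rescale h hr _ hξ]

theorem NonExplosive.rescale (h_ne : NonExplosive h) {r : ℝ} (hr : 0 < r) :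
    NonExplosive (h.rescale r hr) := by
  intro ξ hξ
  have hm : ∀ (k : MajorizingKernel) ζ, Measurable (explosionTime k ζ) := fun k ζ =>
    Measurable.iSup fun n => measurable_explosionTimeAt k n ζ
  have hξ' : r⁻¹ • ξ ≠ 0 := smul_ne_zero (inv_ne_zero hr.ne') hξ
  have key := congrArg (fun μ => μ (Iio ⊤)) (map_explosionTime_rescale h hr hξ')
  simp only [smul_smul, mul_inv_cancel₀ hr.ne', one_smul] at key
  rw [Measure.map_apply ((hm _ _).const_mul _) measurableSet_Iio,
    Measure.map_apply (hm _ _) measurableSet_Iio] at key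
  refine (Eq.trans ?_ key).trans (h_ne _ hξ')
  congr 1
  ext ω
  have hr2 : ENNReal.ofReal (r ^ 2) ≠ 0 := by simpa using hr.ne'
  simp [hr2, lt_top_iff_ne_top, ENNReal.mul_eq_top]

end scaling

/-! ### Existence, uniqueness and scale invariance -/

theorem mainTheorem5 (ν T : ℝ) (hν : 0 < ν) (hT : 0 < T) (h : MajorizingKernel)
    (h_ne : NonExplosive h) (u₀ : Mode → CVec) (hu₀ : Measurable u₀) :
    -- the stochastic cascade is almost surely well defined
    (∀ ξ : Mode, ξ ≠ 0 → ∀ t : ℝ, ∀ᵐ ω ∂cascadeMeasure, (genealogy h ν ξ t ω).Finite) ∧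
    -- if its expectations exist, the cascade solution is a mild solution with these expectations
    (CascadeExpectationExists h ν T u₀ →
      IsMildSolution ν T u₀ (cascadeSolution h ν u₀) ∧
      HasCascadeExpectations h ν T (cascadeSolution h ν u₀) ∧
      ((∀ ξ : Mode, realDot ξ (u₀ ξ) = 0) →
        ∀ ξ : Mode, ξ ≠ 0 → ∀ t ∈ Icc 0 T, realDot ξ (cascadeSolution h ν u₀ ξ t) = 0)) ∧
    -- and there is no other one
    (∀ v : Mode → ℝ → CVec, IsMildSolution ν T u₀ v → HasCascadeExpectations h ν T v →
      CascadeExpectationExists h ν T u₀ ∧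
      ∀ ξ : Mode, ξ ≠ 0 → ∀ t ∈ Icc 0 T, v ξ t = cascadeSolution h ν u₀ ξ t) ∧
    -- in particular among the solutions majorized by a multiple `C h` of the kernel, whenever the
    -- expectations of the corresponding majorant products exist (automatic if `C m ≤ 1`, where `m`
    -- is the branching factor)
    (∀ (C : ℝ) (v : Mode → ℝ → CVec),
      (∀ ξ : Mode, ξ ≠ 0 → ∀ t ∈ Icc 0 T,
        ∫⁻ ω, ENNReal.ofReal (majorantProduct h ν C ξ t ω) ∂cascadeMeasure < ⊤) →
      IsMildSolution ν T u₀ v →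
      (∀ ξ : Mode, ξ ≠ 0 → ∀ t ∈ Icc 0 T, ‖v ξ t‖ ≤ C * h ξ) →
      CascadeExpectationExists h ν T u₀ ∧
      ∀ ξ : Mode, ξ ≠ 0 → ∀ t ∈ Icc 0 T, v ξ t = cascadeSolution h ν u₀ ξ t) ∧
    -- the non-explosion condition is critical, i.e. invariant under the Navier-Stokes scaling: up to
    -- the change of the unit of time, the explosion times have the same distribution
    (∀ (r : ℝ) (hr : 0 < r),
      (∀ ξ : Mode, ξ ≠ 0 →
        cascadeMeasure.map
          (fun ω => ENNReal.ofReal (r ^ 2) * explosionTime (h.rescale r hr) (r • ξ) ω) =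
        cascadeMeasure.map (explosionTime h ξ)) ∧
      NonExplosive (h.rescale r hr)) := by
  refine ⟨fun ξ hξ t => ae_finite_genealogy hν h_ne hξ t, fun hex => ⟨?_, ?_, ?_⟩, ?_, ?_, ?_⟩
  · exact isMildSolution_cascadeSolution hν h_ne hu₀ hex
  · exact hasCascadeExpectations_cascadeSolution hν h_ne hu₀ hex
  · exact fun hdiv ξ hξ t ht => realDot_cascadeSolution hdiv hξ (hex ξ hξ t ht)
  · exact fun v hv hE => unique_of_hasCascadeExpectations hν hT.le h_ne hv hE
  · exact fun C v hmaj hv hle => unique_of_norm_le hν hT.le h_ne hu₀ hmaj hv hle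
  · exact fun r hr => ⟨fun ξ hξ => map_explosionTime_rescale h hr hξ, h_ne.rescale hr⟩
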